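/- Let $\mathrm{Ban}$ be the category of real Banach spaces and continuous linear maps, let $\mathrm{pro}(\mathrm{Ban})$ be its category of pro-objects (indexed by small cofiltered categories), and let $\mathrm{Ch}(\mathrm{pro}(\mathrm{Ban}))$ be the category of unbounded chain complexes $\cdots \to V_1 \to V_0 \to V_{-1} \to \cdots$ in $\mathrm{pro}(\mathrm{Ban})$. A morphism in $\mathrm{pro}(\mathrm{Ban})$ is called strict if its coimage maps isomorphically to its image. A complex $C$ is called strictly acyclic if all the maps $d : C_i/Z_iC \to Z_{i-1}C$ are isomorphisms in $\mathrm{pro}(\mathrm{Ban})$, where $Z_iC=\ker(d : C_i \to C_{i-1})$, and a morphism of complexes is called a strict quasi-isomorphism if its cone is strictly acyclic. For a set $I$, let $\ell^{\infty}(I)$ be the Banach space of bounded real functions on $I$, regarded as a complex concentrated in degree $0$, let $\mathrm{cone}(V)$ denote the cone of the identity of $V$, and let $[n]$ denote the shift with $V[n]_i = V_{i+n}$. **Proposition.** The category $\mathrm{Ch}(\mathrm{pro}(\mathrm{Ban}))$ has all small limits and colimits, and it carries a model structure in which the weak equivalences are the strict quasi-isomorphisms and the cofibrations are the levelwise strict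 monomorphisms. This model structure is fibrantly cogenerated, with cogenerating fibrations $$P=\{\mathrm{cone}(\ell^{\infty}(I))[n] \to \ell^{\infty}(I)[n-1]\}_{I,n}$$ and cogenerating trivial fibrations $$Q=\{\mathrm{cone}(\ell^{\infty}(I))[n] \to 0\}_{I,n},$$ where $I$ runs over all sets and $n$ over all integers. That is: the trivial cofibrations (resp. the cofibrations) are the morphisms with the left lifting property with respect to $P$ (resp. $Q$); the codomains of the morphisms in $P$ and $Q$ are cosmall, i.e. presentable as objects of the opposite category; and the fibrations (resp. the trivial fibrations) are the retracts of transfinite inverse compositions of pullbacks of small products of morphisms in $P$ (resp. $Q$). -/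

import Mathlib

open CategoryTheory Limits HomotopicalAlgebra
open scoped ENNReal ZeroObject

universe v u

/-! ### Banach spaces -/

/-- A real Banach space, in the universe `u`. -/
structure Ban : Type (u + 1) where
  /-- the underlying type -/
  carrier : Type u
  [normedAddCommGroup : NormedAddCommGroup carrier]
  [normedSpace : NormedSpace ℝ carrier]
  [completeSpace : CompleteSpace carrier]

namespace Ban

attribute [instance] normedAddCommGroup normedSpace completeSpace

instance : CoeSort Ban.{u} (Type u) := ⟨carrier⟩

/-- The category of real Banach spaces and continuous linear maps. -/
instance : Category.{u} Ban.{u} where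
  Hom V W := V →L[ℝ] W
  id V := ContinuousLinearMap.id ℝ V
  comp f g := ContinuousLinearMap.comp g f

/-- A morphism of `Ban` as a continuous linear map. -/
def hom {V W : Ban.{u}} (f : V ⟶ W) : V →L[ℝ] W := f

/-- A continuous linear map as a morphism of `Ban`. -/
def ofHom {V W : Ban.{u}} (f : V →L[ℝ] W) : V ⟶ W := f

instance : ConcreteCategory Ban.{u} (fun V W => V →L[ℝ] W) where
  hom f := f
  ofHom f := f

@[simp] lemma hom_ofHom {V W : Ban.{u}} (f : V →L[ℝ] W) : hom (ofHom f) = f := rfl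
@[simp] lemma ofHom_hom {V W : Ban.{u}} (f : V ⟶ W) : ofHom (hom f) = f := rfl
@[simp] lemma hom_id (V : Ban.{u}) : hom (𝟙 V) = ContinuousLinearMap.id ℝ V := rfl
@[simp] lemma hom_comp {U V W : Ban.{u}} (f : U ⟶ V) (g : V ⟶ W) :
    hom (f ≫ g) = (hom g).comp (hom f) := rfl

@[ext] lemma hom_ext {V W : Ban.{u}} {f g : V ⟶ W} (h : ∀ x : V, hom f x = hom g x) : f = g :=
  ContinuousLinearMap.ext h

instance : Preadditive Ban.{u} where
  homGroup V W := inferInstanceAs (AddCommGroup (V →L[ℝ] W))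
  add_comp _ _ _ f f' g := ContinuousLinearMap.comp_add (hom g) (hom f) (hom f')
  comp_add _ _ _ f g g' := ContinuousLinearMap.add_comp (hom g) (hom g') (hom f)

@[simp] lemma hom_zero {V W : Ban.{u}} : hom (0 : V ⟶ W) = 0 := rfl
@[simp] lemma hom_add {V W : Ban.{u}} (f g : V ⟶ W) : hom (f + g) = hom f + hom g := rfl

lemma isZero_punit : IsZero (⟨PUnit.{u + 1}⟩ : Ban.{u}) :=
  (IsZero.iff_id_eq_zero _).2 (hom_ext fun _ => Subsingleton.elim _ _)

instance : HasZeroObject Ban.{u} := ⟨⟨_, isZero_punit⟩⟩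

instance : HasBinaryProducts Ban.{u} :=
  have (V W : Ban.{u}) : HasLimit (pair V W) := ⟨⟨{
    cone := BinaryFan.mk (P := ⟨V × W⟩) (ofHom (ContinuousLinearMap.fst ℝ V W))
      (ofHom (ContinuousLinearMap.snd ℝ V W))
    isLimit := BinaryFan.IsLimit.mk _
      (fun f g => ofHom ((hom f).prod (hom g)))
      (fun _ _ => rfl) (fun _ _ => rfl)
      (fun f g m h₁ h₂ => by subst h₁ h₂; rfl) }⟩⟩
  hasBinaryProducts_of_hasLimit_pair _

instance : HasFiniteProducts Ban.{u} := hasFiniteProducts_of_has_binary_and_terminal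

instance : HasFiniteBiproducts Ban.{u} := HasFiniteBiproducts.of_hasFiniteProducts

/-- The kernel of `f` is its closed null space. -/
instance : HasKernels Ban.{u} where
  has_limit {V W} f :=
    have : CompleteSpace (LinearMap.ker (hom f).toLinearMap) :=
      (ContinuousLinearMap.isClosed_ker (hom f)).completeSpace_coe
    ⟨⟨{
      cone := KernelFork.ofι (Z := ⟨LinearMap.ker (hom f).toLinearMap⟩)
        (ofHom (LinearMap.ker (hom f).toLinearMap).subtypeL)
        (hom_ext fun x => x.2)
      isLimit := KernelFork.IsLimit.ofι _ _
        (fun g hg => ofHom ((hom g).codRestrict _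
          (fun x => DFunLike.congr_fun (congrArg hom hg) x)))
        (fun _ _ => rfl)
        (fun g hg m hm => by subst hm; rfl) }⟩⟩

/-- The cokernel of `f` is the quotient by the closure of its range. -/
instance : HasCokernels Ban.{u} where
  has_colimit {V W} f :=
    let S : Submodule ℝ W := (LinearMap.range (hom f).toLinearMap).topologicalClosure
    have hS : IsClosed (S : Set W) := Submodule.isClosed_topologicalClosure _
    have : IsClosed (S.toAddSubgroup : Set W) := hS
    ⟨⟨{
      cocone := CokernelCofork.ofπ (Z := ⟨W ⧸ S⟩) (ofHom S.mkQL)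
        (hom_ext fun x => (Submodule.Quotient.mk_eq_zero S).2
          (Submodule.le_topologicalClosure _ ⟨x, rfl⟩))
      isColimit := CokernelCofork.IsColimit.ofπ _ _
        (fun g hg => ofHom (S.liftQL (hom g) (by
          refine Submodule.topologicalClosure_minimal _ ?_
            (ContinuousLinearMap.isClosed_ker (hom g))
          rintro _ ⟨x, rfl⟩
          exact DFunLike.congr_fun (congrArg hom hg) x)))
        (fun g hg => hom_ext fun x => rfl)
        (fun g hg m hm => by
          subst hm
          refine hom_ext fun x => ?_
          obtain ⟨x, rfl⟩ := Submodule.Quotient.mk_surjective S x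
          rfl) }⟩⟩

instance : HasEqualizers Ban.{u} := Preadditive.hasEqualizers_of_hasKernels

instance : HasCoequalizers Ban.{u} := Preadditive.hasCoequalizers_of_hasCokernels

instance : HasFiniteLimits Ban.{u} := hasFiniteLimits_of_hasEqualizers_and_finite_products

instance : HasFiniteColimits Ban.{u} := hasFiniteColimits_of_hasCoequalizers_and_finite_coproducts

/-- The Banach space `ℓ^∞(I)` of bounded real functions on a set `I`. -/
noncomputable def linf (I : Type u) : Ban.{u} := ⟨lp (fun _ : I => ℝ) ∞⟩

end Ban

/-! ### Pro-objects -/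

namespace CategoryTheory

/-- An ind-object is a left exact presheaf: it is a filtered colimit of representable ones. -/
lemma Limits.IsIndObject.preservesFiniteLimits {C : Type u} [Category.{v} C]
    {F : Cᵒᵖ ⥤ Type v} (hF : IsIndObject F) : PreservesFiniteLimits F := by
  let P := hF.presentation
  have h : PreservesFiniteLimits (P.F ⋙ yoneda).flip :=
    preservesFiniteLimits_of_evaluation _ fun i =>
      inferInstanceAs (PreservesFiniteLimits (yoneda.obj (P.F.obj i)))
  have e : (P.F ⋙ yoneda).flip ⋙ colim ≅ F :=
    (colimitIsoFlipCompColim _).symm ≪≫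
      (colimit.isColimit _).coconePointUniqueUpToIso P.isColimit
  exact preservesFiniteLimits_of_natIso e

namespace Ind

variable (C : Type u) [Category.{v} C]

/-- The functor sending an ind-object to the left exact presheaf of sets that it represents. -/
noncomputable def toLeftExactFunctor : Ind C ⥤ (Cᵒᵖ ⥤ₗ Type v) :=
  ObjectProperty.lift _ (Ind.inclusion C) fun X => by
    simpa only [leftExactFunctor_iff] using (Ind.isIndObject_inclusion_obj X).preservesFiniteLimits

/-- The functor `Ind.toLeftExactFunctor` is fully faithful. -/
noncomputable def toLeftExactFunctorFullyFaithful : (toLeftExactFunctor C).FullyFaithful where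
  preimage f := (Ind.inclusion.fullyFaithful).preimage f.hom
  map_preimage f := by
    apply ObjectProperty.hom_ext
    exact (Ind.inclusion.fullyFaithful).map_preimage f.hom
  preimage_map f := (Ind.inclusion.fullyFaithful).preimage_map f

/-- The additive structure on ind-objects in an additive category with finite colimits: left exact
presheaves of sets are canonically left exact presheaves of abelian groups, so morphisms of
ind-objects are added as morphisms of presheaves of abelian groups. -/
@[reducible]
noncomputable def preadditiveOfLocallySmall [Preadditive C] [HasFiniteBiproducts C] :
    Preadditive (Ind C) :=
  haveI : HasFiniteBiproducts Cᵒᵖ := HasFiniteBiproducts.of_hasFiniteProducts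
  .ofFullyFaithful (((toLeftExactFunctorFullyFaithful C).comp
    (AddCommGrpCat.leftExactFunctorForgetEquivalence _).symm.fullyFaithfulFunctor).comp
      (ObjectProperty.fullyFaithfulι _))

end Ind

/-- The category `pro(C)` of pro-objects of `C`: the formal small cofiltered limits of objects
of `C`, i.e. the opposite of the category of ind-objects of the opposite category. -/
abbrev Pro (C : Type u) [Category.{v} C] : Type (max u (v + 1)) := (Ind Cᵒᵖ)ᵒᵖ

/-- The embedding of `C` into `pro(C)` by constant inverse systems. -/
noncomputable def Pro.const (C : Type u) [Category.{v} C] : C ⥤ Pro C :=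
  (Ind.yoneda (C := Cᵒᵖ)).rightOp

end CategoryTheory

/-- The category `pro(Ban)` of pro-Banach spaces. -/
abbrev ProBan : Type (u + 1) := Pro Ban.{u}

instance : HasFiniteBiproducts Ban.{u}ᵒᵖ := HasFiniteBiproducts.of_hasFiniteProducts

noncomputable instance : Preadditive (Ind Ban.{u}ᵒᵖ) := Ind.preadditiveOfLocallySmall _

noncomputable instance : Preadditive ProBan.{u} := inferInstance
instance : HasFiniteLimits ProBan.{u} := inferInstance
instance : HasFiniteColimits ProBan.{u} := inferInstance
instance : HasFiniteBiproducts ProBan.{u} := HasFiniteBiproducts.of_hasFiniteProducts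
instance : HasBinaryBiproducts ProBan.{u} := hasBinaryBiproducts_of_finite_biproducts _
instance : HasZeroObject ProBan.{u} := inferInstance
instance : HasKernels ProBan.{u} := inferInstance
instance : HasCokernels ProBan.{u} := inferInstance

/-- The category `Ch(pro(Ban))` of unbounded chain complexes of pro-Banach spaces. -/
abbrev ChProBan : Type (u + 1) := ChainComplex ProBan.{u} ℤ

/-! ### Weak equivalences and cofibrations -/

section Strict

variable {C : Type u} [Category.{v} C] [Preadditive C] [HasKernels C] [HasCokernels C]

/-- A morphism is strict if its coimage maps isomorphically to its image, where
`im f = ker (coker f)` and `coim f = coker (ker f)`. -/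
def IsStrict {X Y : C} (f : X ⟶ Y) : Prop := IsIso (Abelian.coimageImageComparison f)

/-- The map `X / ker f ⟶ ker g` induced by `f`, for composable `f`, `g` with `f ≫ g = 0`. -/
noncomputable def coimageToKernel {X Y Z : C} (f : X ⟶ Y) (g : Y ⟶ Z) (w : f ≫ g = 0) :
    Abelian.coimage f ⟶ kernel g :=
  cokernel.desc (kernel.ι f) (kernel.lift g f w) (by ext; simp)

/-- A chain complex `K` is strictly acyclic if all the maps `d : K_i / Z_i K ⟶ Z_{i-1} K` are
isomorphisms, where `Z_i K` is the kernel of `d : K_i ⟶ K_{i-1}`. -/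
def IsStrictlyAcyclic (K : ChainComplex C ℤ) : Prop :=
  ∀ i : ℤ, IsIso (coimageToKernel (K.d i (i - 1)) (K.d (i - 1) (i - 2)) (K.d_comp_d _ _ _))

variable (C)

/-- The class of strict quasi-isomorphisms: the morphisms whose cone is strictly acyclic. -/
def strictQuasiIso [HasBinaryBiproducts C] : MorphismProperty (ChainComplex C ℤ) :=
  fun _ _ f => IsStrictlyAcyclic (HomologicalComplex.homotopyCofiber f)

/-- The class of levelwise strict monomorphisms of chain complexes. -/
def levelwiseStrictMono : MorphismProperty (ChainComplex C ℤ) :=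
  fun _ _ f => ∀ i : ℤ, Mono (f.f i) ∧ IsStrict (f.f i)

end Strict

/-! ### Cogenerating fibrations -/

section Cogenerators

variable {C : Type u} [Category.{v} C] [Preadditive C] [HasZeroObject C]

/-- The cone of the identity of an object `V`, shifted so that it is the complex
`⋯ ⟶ 0 ⟶ V ⟶ V ⟶ 0 ⟶ ⋯` in degrees `m` and `m - 1`, with the identity as differential. -/
noncomputable abbrev shiftedCone (V : C) (m : ℤ) : ChainComplex C ℤ :=
  HomologicalComplex.double (𝟙 V) (show (ComplexShape.down ℤ).Rel m (m - 1) by simp)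

/-- The projection of the shifted cone of `V` in degrees `m` and `m - 1` to the complex `V`
concentrated in degree `m`; it is the identity of `V` in degree `m`. -/
noncomputable def shiftedConeProj (V : C) (m : ℤ) :
    shiftedCone V m ⟶ (HomologicalComplex.single C (ComplexShape.down ℤ) m).obj V :=
  HomologicalComplex.mkHomToSingle (HomologicalComplex.doubleXIso₀ (𝟙 V) _).hom
    (fun i hi => by
      rw [HomologicalComplex.double_d_eq_zero₀ _ _ _ _ (by rintro rfl; simp at hi), zero_comp])

end Cogenerators

namespace ChProBan

/-- The class `P` of the morphisms `cone(ℓ^∞(I))[n] ⟶ ℓ^∞(I)[n - 1]` for all sets `I` and all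
integers `n`. Here `[n]` lowers degrees by `n`, so the target is `ℓ^∞(I)` in degree `m = 1 - n`. -/
noncomputable def cogeneratingFibrations : MorphismProperty ChProBan.{u} :=
  .ofHoms fun p : Type u × ℤ => shiftedConeProj ((Pro.const _).obj (Ban.linf p.1)) (1 - p.2)

/-- The class `Q` of the morphisms `cone(ℓ^∞(I))[n] ⟶ 0` for all sets `I` and all integers `n`. -/
noncomputable def cogeneratingTrivialFibrations : MorphismProperty ChProBan.{u} :=
  .ofHoms fun p : Type u × ℤ =>
    (0 : shiftedCone ((Pro.const _).obj (Ban.linf.{u} p.1)) (1 - p.2) ⟶ 0)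

end ChProBan

/-! ### Fibrantly cogenerated model structures -/

section ModelStructure

variable {C : Type u} [Category.{v} C]

/-- The class of retracts of `P`-cocell complexes, a `P`-cocell complex being a transfinite
(inverse) composition of base changes of small products of morphisms in `P`. This is the dual of
the class of retracts of relative cell complexes. -/
def retractsCocell (P : MorphismProperty C) : MorphismProperty C :=
  (MorphismProperty.transfiniteCompositions.{v}
    (MorphismProperty.coproducts.{v} P.op).pushouts).retracts.unop

variable (C)

/-- A model structure is fibrantly cogenerated by classes `P` of fibrations and `Q` of trivial
fibrations if the trivial cofibrations (resp. the cofibrations) are the morphisms with the left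
lifting property with respect to `P` (resp. `Q`), the codomains of the morphisms in `P` and `Q` are
cosmall, and the fibrations (resp. the trivial fibrations) are the retracts of the `P`-cocell (resp.
`Q`-cocell) complexes. -/
structure IsFibrantlyCogenerated [ModelCategory C] (P Q : MorphismProperty C) : Prop where
  trivialCofibrations_eq : trivialCofibrations C = P.llp
  cofibrations_eq : cofibrations C = Q.llp
  fibrations_eq : fibrations C = retractsCocell P
  trivialFibrations_eq : trivialFibrations C = retractsCocell Q
  cosmall_cod {X Y : C} (f : X ⟶ Y) (hf : P f) : IsPresentable.{v} (Opposite.op Y)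
  cosmall_cod' {X Y : C} (f : X ⟶ Y) (hf : Q f) : IsPresentable.{v} (Opposite.op Y)

end ModelStructure

/-! ### Strict monomorphisms and strict exactness -/

section StrictMono

variable {C : Type u} [Category.{v} C] [Preadditive C] [HasKernels C] [HasCokernels C]

/-! The spaces `ℓ^∞(I)` are injective for kernels, and every pro-Banach space is the kernel of a map
out of a product of them (`ProBan.isInjectiveCogenerator_linf`). Injectivity in `Ban` is Hahn–Banach
in each coordinate. It passes to pro-objects because a parallel pair of ind-objects of `Banᵒᵖ` can
be presented levelwise and representables are finitely presentable. Isometric embeddings into `ℓ^∞`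
of the dual unit ball give the cogeneration.

The rest is formal for any such family `V`, whose members are moreover cosmall. Everything is read
off from the functors `Hom(-, V i)`: strict monomorphisms are the maps along which morphisms to the
`V i` extend (`IsInjectiveCogenerator.mono_and_isStrict_iff`), and strict quasi-isomorphisms are the
maps that these functors turn into quasi-isomorphisms (`IsInjectiveCogenerator.strictQuasiIso_eq`).
Since a map to `shiftedCone (V i) m` is just a map to `V i` in degree `m - 1`, the lifting
properties against `P` and `Q` become explicit, and they identify the cofibrations with the maps
lifting against `Q`, and those that are also weak equivalences with the maps lifting against `P`
(`conesProj_llp_eq`).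

For the factorizations, one pullback of a product suffices for `Q`. For `P` a countable small object
argument in the opposite category is run. The class `P` is not small, but all squares from a given
map to members of `P` factor through a small set of them (`exists_conesProj_step`).

Limits of pro-objects are formal. Colimits need an argument, as `Ban` has no infinite coproducts in
general: `ℓ¹`-sums with rescaled inclusions form a small weak substitute
(`Ban.exists_weakCoproducts`). -/

lemma mono_and_isStrict_iff {X Y : C} (f : X ⟶ Y) :
    Mono f ∧ IsStrict f ↔
      IsIso (kernel.lift (cokernel.π f) f (cokernel.condition f)) := by
  have fac : Abelian.coimage.π f ≫ Abelian.coimageImageComparison f =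
      kernel.lift (cokernel.π f) f (cokernel.condition f) := by
    rw [← cancel_mono (kernel.ι (cokernel.π f)), kernel.lift_ι, Category.assoc]
    exact Abelian.coimage_image_factorisation f
  -- A monomorphism has zero kernel, hence is its own coimage up to isomorphism; `fac` then compares
  -- the two maps to the image.
  have isIso_π [Mono f] : IsIso (Abelian.coimage.π f) := by
    have : kernel.ι f = 0 := by
      rw [← cancel_mono f, kernel.condition, zero_comp]
    have h (g : X ⟶ X) (hg : g = 𝟙 X) : kernel.ι f ≫ g = 0 := by rw [hg, this, zero_comp]
    refine ⟨cokernel.desc (kernel.ι f) (𝟙 X) (h _ rfl), cokernel.π_desc _ _ _, ?_⟩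
    rw [← cancel_epi (cokernel.π (kernel.ι f))]
    exact (cokernel.π_desc_assoc _ _ _ _).trans (by rw [Category.id_comp, Category.comp_id])
  constructor
  · rintro ⟨_, h⟩
    have : IsIso (Abelian.coimageImageComparison f) := h
    have := isIso_π
    rw [← fac]
    infer_instance
  · intro h
    have : Mono f := by
      rw [← kernel.lift_ι (cokernel.π f) f (cokernel.condition f)]
      infer_instance
    have := isIso_π
    exact ⟨‹Mono f›, IsIso.of_isIso_fac_left fac⟩

end StrictMono

/-! ### Extension properties and injective cogenerators -/

section HasExtensions

variable {C : Type u} [Category.{v} C]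

/-- A morphism `f : X ⟶ Y` has extensions to the objects `V i` if every morphism `X ⟶ V i` extends
along `f`. -/
def hasExtensions {ι : Type*} (V : ι → C) : MorphismProperty C :=
  fun X _ f => ∀ (i : ι) (a : X ⟶ V i), ∃ b, f ≫ b = a

lemma hasExtensions.exists_extension_pi {ι : Type*} {V : ι → C} {X Y : C} {f : X ⟶ Y}
    (hf : hasExtensions V f) {K : Type*} (k : K → ι) [HasProduct fun j => V (k j)]
    (a : X ⟶ ∏ᶜ fun j => V (k j)) : ∃ b, f ≫ b = a := by
  choose b hb using fun j => hf (k j) (a ≫ Pi.π _ j)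
  exact ⟨Pi.lift b, by ext j; simp [hb]⟩

lemma hasExtensions.of_comp {ι : Type*} {V : ι → C} {X Y Z : C} {f : X ⟶ Y} {g : Y ⟶ Z}
    (h : hasExtensions V (f ≫ g)) : hasExtensions V f := fun i a => by
  obtain ⟨b, hb⟩ := h i a
  exact ⟨g ≫ b, by rw [← hb, Category.assoc]⟩

lemma hasExtensions.of_isLimit [Preadditive C] {ι : Type*} {V : ι → C} {X Y Z : C} {e : X ⟶ Y}
    {g : Y ⟶ Z} [HasKernel g] (hg : hasExtensions V (kernel.ι g)) {w : e ≫ g = 0}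
    (h : IsLimit (KernelFork.ofι e w)) : hasExtensions V e := fun i a => by
  let φ : kernel g ⟶ X := h.lift (KernelFork.ofι (kernel.ι g) (kernel.condition g))
  have hφ : φ ≫ e = kernel.ι g := h.fac _ WalkingParallelPair.zero
  have : Mono e := mono_of_isLimit_fork h
  have hφ' : kernel.lift g e w ≫ φ = 𝟙 X := by
    rw [← cancel_mono e, Category.assoc, hφ, kernel.lift_ι, Category.id_comp]
  obtain ⟨b, hb⟩ := hg i (φ ≫ a)
  refine ⟨b, ?_⟩
  rw [← kernel.lift_ι g e w, Category.assoc, hb, reassoc_of% hφ']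

end HasExtensions

/-- A family of injective objects (for the exact structure given by the kernels) such that every
object is the kernel of a morphism defined on a small product of objects of the family. -/
structure IsInjectiveCogenerator {C : Type u} [Category.{v} C] [Preadditive C] [HasKernels C]
    [HasProducts.{v} C] {ι : Type*} (V : ι → C) : Prop where
  hasExtensions_kernel {X Y : C} (g : X ⟶ Y) : hasExtensions V (kernel.ι g)
  exists_kernelFork (X : C) : ∃ (K : Type v) (k : K → ι) (Z : C) (e : X ⟶ ∏ᶜ fun j => V (k j))
    (g : (∏ᶜ fun j => V (k j)) ⟶ Z) (w : e ≫ g = 0), Nonempty (IsLimit (KernelFork.ofι e w))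

namespace IsInjectiveCogenerator

variable {C : Type u} [Category.{v} C] [Preadditive C] [HasKernels C] [HasProducts.{v} C]
  {ι : Type*} {V : ι → C} (hV : IsInjectiveCogenerator V)
include hV

lemma hasExtensions_of_isLimit {X Y Z : C} {e : X ⟶ Y} {g : Y ⟶ Z} {w : e ≫ g = 0}
    (h : IsLimit (KernelFork.ofι e w)) : hasExtensions V e :=
  (hV.hasExtensions_kernel g).of_isLimit h

lemma exists_embedding (X : C) : ∃ (K : Type v) (k : K → ι) (e : X ⟶ ∏ᶜ fun j => V (k j)),
    Mono e ∧ hasExtensions V e := by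
  obtain ⟨K, k, Z, e, g, w, ⟨h⟩⟩ := hV.exists_kernelFork X
  exact ⟨K, k, e, mono_of_isLimit_fork h, hV.hasExtensions_of_isLimit h⟩

lemma eq_of_forall_comp_eq {X Y : C} {f g : X ⟶ Y} (h : ∀ i (a : Y ⟶ V i), f ≫ a = g ≫ a) :
    f = g := by
  obtain ⟨K, k, e, _, _⟩ := hV.exists_embedding Y
  rw [← cancel_mono e]
  ext j
  simp only [Category.assoc, h]

/-- Write `X` as a kernel inside a product of objects `V i`. The embedding extends to `Y`, and the
extension still lands in `X` because `f` is epi. This gives a retraction, and a split monomorphism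
that is epi is invertible. -/
lemma isIso_of_epi {X Y : C} (f : X ⟶ Y) (h₁ : hasExtensions V f) [Epi f] : IsIso f := by
  obtain ⟨K, k, Z, e, g, w, ⟨he⟩⟩ := hV.exists_kernelFork X
  obtain ⟨b, hb⟩ := h₁.exists_extension_pi k e
  have hbg : b ≫ g = 0 := by rw [← cancel_epi f, reassoc_of% hb, w, comp_zero]
  let r : Y ⟶ X := he.lift (KernelFork.ofι b hbg)
  have hr : r ≫ e = b := he.fac _ WalkingParallelPair.zero
  have : Mono e := mono_of_isLimit_fork he
  have hfr : f ≫ r = 𝟙 X := by rw [← cancel_mono e, Category.assoc, hr, hb, Category.id_comp]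
  exact ⟨r, hfr, by rw [← cancel_epi f, reassoc_of% hfr, Category.comp_id]⟩

variable [HasCokernels C]

lemma isIso_kernelLift_iff {X Y : C} (f : X ⟶ Y) :
    IsIso (kernel.lift (cokernel.π f) f (cokernel.condition f)) ↔ hasExtensions V f := by
  let f' := kernel.lift (cokernel.π f) f (cokernel.condition f)
  have hf' : f' ≫ kernel.ι _ = f := kernel.lift_ι _ _ _
  constructor
  · intro (_ : IsIso f') i a
    obtain ⟨b, hb⟩ := hV.hasExtensions_kernel (cokernel.π f) i (inv f' ≫ a)
    exact ⟨b, by rw [← hf', Category.assoc, hb, IsIso.hom_inv_id_assoc]⟩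
  · intro h
    -- By separation it suffices to test on maps to the `V i`. Such a map extends from the kernel to
    -- `Y`; the extension kills `f`, so it factors through the cokernel and vanishes on the kernel.
    have : Epi f' := by
      refine Preadditive.epi_of_cancel_zero _ fun {W} g hg => ?_
      refine hV.eq_of_forall_comp_eq fun i a => ?_
      obtain ⟨b, hb⟩ := hV.hasExtensions_kernel (cokernel.π f) i (g ≫ a)
      have hfb : f ≫ b = 0 := by rw [← hf', Category.assoc, hb, reassoc_of% hg, zero_comp]
      rw [← hb, ← cokernel.π_desc f b hfb, kernel.condition_assoc, zero_comp, zero_comp]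
    refine hV.isIso_of_epi f' (hasExtensions.of_comp (g := kernel.ι _) ?_)
    rwa [hf']

lemma mono_and_isStrict_iff {X Y : C} (f : X ⟶ Y) :
    Mono f ∧ IsStrict f ↔ hasExtensions V f := by
  rw [_root_.mono_and_isStrict_iff, hV.isIso_kernelLift_iff]

end IsInjectiveCogenerator

/-- Exactness at `Y` of the sequences obtained from `X ⟶ Y ⟶ Z` by applying `Hom(-, V i)`. -/
def HomExact {C : Type u} [Category.{v} C] [HasZeroMorphisms C] {ι : Type*} (V : ι → C)
    {X Y Z : C} (f : X ⟶ Y) (g : Y ⟶ Z) : Prop :=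
  ∀ (i : ι) (b : Y ⟶ V i), f ≫ b = 0 → ∃ c, g ≫ c = b

/-! ### Strict exactness in terms of `Hom(-, V i)` -/

section StrictExact

variable {C : Type u} [Category.{v} C] [Preadditive C] [HasKernels C] [HasCokernels C]

lemma π_coimageToKernel_ι {X Y Z : C} (f : X ⟶ Y) (g : Y ⟶ Z) (w : f ≫ g = 0) :
    cokernel.π (kernel.ι f) ≫ coimageToKernel f g w ≫ kernel.ι g = f :=
  (cokernel.π_desc_assoc _ _ _ _).trans (kernel.lift_ι _ _ _)

variable [HasProducts.{v} C] {ι : Type*} {V : ι → C} (hV : IsInjectiveCogenerator V)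
include hV

/-- A map `b` killed by `f` vanishes on `ker g`, so it descends to the coimage of `g`, which is `ker
h`; from there it extends to `X₁` by injectivity. -/
lemma IsInjectiveCogenerator.homExact {X₃ X₂ X₁ X₀ : C} {f : X₃ ⟶ X₂} {g : X₂ ⟶ X₁} {h : X₁ ⟶ X₀}
    (w : f ≫ g = 0) (w' : g ≫ h = 0) (hf : IsIso (coimageToKernel f g w))
    (hg : IsIso (coimageToKernel g h w')) : HomExact V f g := fun i b hb => by
  have h₀ : kernel.ι g ≫ b = 0 := by
    rw [← cancel_epi (coimageToKernel f g w), ← cancel_epi (cokernel.π (kernel.ι f)),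
      reassoc_of% π_coimageToKernel_ι f g w, hb, comp_zero, comp_zero]
  obtain ⟨c, hc⟩ := hV.hasExtensions_kernel h i
    (inv (coimageToKernel g h w') ≫ cokernel.desc (kernel.ι g) b h₀)
  refine ⟨c, ?_⟩
  conv_lhs => rw [← π_coimageToKernel_ι g h w']
  rw [Category.assoc, Category.assoc, hc, IsIso.hom_inv_id_assoc, cokernel.π_desc]

/-- Exactness of `Hom(-, V i)` says that the maps from `coker f` to `X₁` and from `coker g` to `X₀`
are kernels of their cokernels. Monicity of the second lets `ker h` factor through the first, and
the resulting map `t` yields the inverse. -/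
lemma IsInjectiveCogenerator.isIso_coimageToKernel {X₃ X₂ X₁ X₀ : C} {f : X₃ ⟶ X₂} {g : X₂ ⟶ X₁}
    {h : X₁ ⟶ X₀} (w : f ≫ g = 0) (w' : g ≫ h = 0) (hf : HomExact V f g)
    (hg : HomExact V g h) : IsIso (coimageToKernel g h w') := by
  have key {A B D : C} {p : A ⟶ B} {q : B ⟶ D} (w : p ≫ q = 0) (hp : HomExact V p q) :
      IsIso (kernel.lift (cokernel.π (cokernel.desc p q w)) _ (cokernel.condition _)) := by
    rw [hV.isIso_kernelLift_iff]
    intro i a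
    obtain ⟨c, hc⟩ := hp i (cokernel.π p ≫ a) (by rw [cokernel.condition_assoc, zero_comp])
    exact ⟨c, by rw [← cancel_epi (cokernel.π p), cokernel.π_desc_assoc, hc]⟩
  have mono_of {A B D : C} {p : A ⟶ B} {q : B ⟶ D} (w : p ≫ q = 0) (hp : HomExact V p q) :
      Mono (cokernel.desc p q w) := ((_root_.mono_and_isStrict_iff _).2 (key w hp)).1
  let s := cokernel.desc f g w
  have hs : cokernel.π f ≫ s = g := cokernel.π_desc _ _ _
  have := mono_of w hf
  have := mono_of w' hg
  have := key w hf
  have hgs : g ≫ cokernel.π s = 0 := by rw [← hs, Category.assoc, cokernel.condition, comp_zero]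
  have hι : kernel.ι h ≫ cokernel.π g = 0 := by
    rw [← cancel_mono (cokernel.desc g h w'), Category.assoc, cokernel.π_desc, kernel.condition,
      zero_comp]
  have hι' : kernel.ι h ≫ cokernel.π s = 0 := by
    rw [← cokernel.π_desc g (cokernel.π s) hgs, reassoc_of% hι, zero_comp]
  let t : kernel h ⟶ cokernel f := kernel.lift (cokernel.π s) (kernel.ι h) hι' ≫
    inv (kernel.lift (cokernel.π s) s (cokernel.condition s))
  have ht : t ≫ s = kernel.ι h := by
    have : inv (kernel.lift (cokernel.π s) s (cokernel.condition s)) ≫ s =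
        kernel.ι (cokernel.π s) := by rw [IsIso.inv_comp_eq, kernel.lift_ι]
    rw [Category.assoc, this, kernel.lift_ι]
  have hfg : f ≫ cokernel.π (kernel.ι g) = 0 := by
    rw [← kernel.lift_ι g f w, Category.assoc, cokernel.condition, comp_zero]
  let j : cokernel f ⟶ cokernel (kernel.ι g) := cokernel.desc f _ hfg
  have hj : cokernel.π f ≫ j = cokernel.π (kernel.ι g) := cokernel.π_desc _ _ _
  have hjs : j ≫ coimageToKernel g h w' ≫ kernel.ι h = s := by
    rw [← cancel_epi (cokernel.π f), reassoc_of% hj, π_coimageToKernel_ι, hs]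
  refine ⟨t ≫ j, ?_, ?_⟩
  · have : cokernel.π (kernel.ι g) ≫ coimageToKernel g h w' ≫ t = cokernel.π f := by
      rw [← cancel_mono s, Category.assoc, Category.assoc, ht, π_coimageToKernel_ι, hs]
    refine (cancel_epi (cokernel.π (kernel.ι g))).1 ?_
    rw [reassoc_of% this, hj]
    exact (Category.comp_id _).symm
  · rw [← cancel_mono (kernel.ι h), Category.assoc, Category.assoc, hjs, ht, Category.id_comp]

end StrictExact

/-! ### Strict quasi-isomorphisms -/

section QuasiIso

variable {C : Type u} [Category.{v} C] [Preadditive C] {ι : Type*}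

/-- A morphism of chain complexes `f : K ⟶ L` is a `Hom`-quasi-isomorphism with respect to a family
of objects `V i` if it induces quasi-isomorphisms `Hom(L, V i) ⟶ Hom(K, V i)`. -/
structure IsHomQuasiIso (V : ι → C) {K L : ChainComplex C ℤ} (f : K ⟶ L) : Prop where
  surj {n m l : ℤ} (hn : m + 1 = n) (hl : l + 1 = m) (i : ι) (a : K.X m ⟶ V i)
    (ha : K.d n m ≫ a = 0) : ∃ (b : L.X m ⟶ V i) (c : K.X l ⟶ V i),
      L.d n m ≫ b = 0 ∧ a = f.f m ≫ b + K.d m l ≫ c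
  inj {n m l : ℤ} (hn : m + 1 = n) (hl : l + 1 = m) (i : ι) (b : L.X m ⟶ V i)
    (hb : L.d n m ≫ b = 0) (a : K.X l ⟶ V i) (h : f.f m ≫ b = K.d m l ≫ a) :
      ∃ c : L.X l ⟶ V i, b = L.d m l ≫ c

/-- The right-hand side is acyclicity of the mapping cone of `Hom(L, V i) ⟶ Hom(K, V i)`: a cocycle
is a pair `(b, a)`, and it has to be a coboundary. -/
lemma isHomQuasiIso_iff (V : ι → C) {K L : ChainComplex C ℤ} (f : K ⟶ L) :
    IsHomQuasiIso V f ↔ ∀ {n m l k : ℤ} (_ : m + 1 = n) (_ : l + 1 = m) (_ : k + 1 = l) (i : ι)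
      (b : L.X m ⟶ V i) (a : K.X l ⟶ V i) (_ : L.d n m ≫ b = 0)
      (_ : f.f m ≫ b = K.d m l ≫ a), ∃ (b' : L.X l ⟶ V i) (a' : K.X k ⟶ V i),
        L.d m l ≫ b' = b ∧ a = f.f l ≫ b' + K.d l k ≫ a' := by
  constructor
  · intro hf n m l k hn hl hk i b a hb hab
    obtain ⟨c, rfl⟩ := hf.inj hn hl i b hb a hab
    obtain ⟨b₁, a', hb₁, ha'⟩ := hf.surj hl hk i (a - f.f l ≫ c) (by
      rw [Preadditive.comp_sub, ← hab, f.comm_assoc, sub_self])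
    refine ⟨c + b₁, a', by rw [Preadditive.comp_add, hb₁, add_zero], ?_⟩
    rw [Preadditive.comp_add, add_assoc, ← ha']
    abel
  · intro hf
    refine ⟨fun {n m l} hn hl i a ha => ?_, fun {n m l} hn hl i b hb a h => ?_⟩
    -- Surjectivity on cohomology is the case of cocycles `(0, a)`.
    · obtain ⟨b, c, hb, hc⟩ := hf (n := n + 1) rfl hn hl i 0 a (by simp) (by simp [ha])
      exact ⟨b, c, hb, hc⟩
    · obtain ⟨b', _, hb', _⟩ := hf hn hl (k := l - 1) (by simp) i b a hb h
      exact ⟨b', hb'.symm⟩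

variable (C) in
/-- The class of `Hom`-quasi-isomorphisms with respect to a family of objects. -/
def homQuasiIso (V : ι → C) : MorphismProperty (ChainComplex C ℤ) :=
  fun _ _ f => IsHomQuasiIso V f

/-- This is the source of two-out-of-three for strict quasi-isomorphisms; it is checked directly on
cocycles. -/
instance (V : ι → C) : (homQuasiIso C V).HasTwoOutOfThreeProperty where
  comp_mem {K L M} f g hf hg := by
    refine ⟨fun {n m l} hn hl i a ha => ?_, fun {n m l} hn hl i b hb a h => ?_⟩
    · obtain ⟨b, c, hb, rfl⟩ := hf.surj hn hl i a ha
      obtain ⟨b₂, c₂, hb₂, rfl⟩ := hg.surj hn hl i b hb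
      exact ⟨b₂, f.f l ≫ c₂ + c, hb₂, by simp [add_assoc]⟩
    · obtain ⟨c, hc⟩ := hf.inj hn hl i (g.f m ≫ b) (by rw [← g.comm_assoc, hb, comp_zero]) a
        (by simpa using h)
      exact hg.inj hn hl i b hb c hc
  of_postcomp {K L M} f g hg hfg := by
    refine ⟨fun {n m l} hn hl i a ha => ?_, fun {n m l} hn hl i b hb a h => ?_⟩
    · obtain ⟨b, c, hb, hc⟩ := hfg.surj hn hl i a ha
      exact ⟨g.f m ≫ b, c, by rw [← g.comm_assoc, hb, comp_zero], by simpa using hc⟩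
    · obtain ⟨b₂, c, hb₂, rfl⟩ := hg.surj hn hl i b hb
      obtain ⟨c₂, rfl⟩ := hfg.inj hn hl i b₂ hb₂ (a - f.f l ≫ c) (by
        simp only [Preadditive.comp_sub, ← h]
        simp)
      exact ⟨g.f l ≫ c₂ + c, by simp⟩
  of_precomp {K L M} f g hf hfg := by
    refine ⟨fun {n m l} hn hl i a ha => ?_, fun {n m l} hn hl i b hb a h => ?_⟩
    · obtain ⟨b, c, hb, hc⟩ := hfg.surj hn hl i (f.f m ≫ a) (by
        rw [← f.comm_assoc, ha, comp_zero])
      obtain ⟨c', hc'⟩ := hf.inj hn hl i (a - g.f m ≫ b)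
        (by rw [Preadditive.comp_sub, ha, ← g.comm_assoc, hb, comp_zero, sub_zero]) c
        (by simp [hc])
      exact ⟨b, c', hb, by rw [← hc']; abel⟩
    · exact hfg.inj hn hl i b hb (f.f l ≫ a) (by simp [h])

/-- Maps out of the cone of `f` split into a component on `K` and one on `L`, so `Hom` out of the
cone is, up to shift and signs, the mapping cone appearing in `isHomQuasiIso_iff`. -/
lemma forall_homExact_homotopyCofiber_iff [HasBinaryBiproducts C] (V : ι → C)
    {K L : ChainComplex C ℤ} (f : K ⟶ L) :
    (∀ {n m l : ℤ} (_ : m + 1 = n) (_ : l + 1 = m),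
      HomExact V ((HomologicalComplex.homotopyCofiber f).d n m)
        ((HomologicalComplex.homotopyCofiber f).d m l)) ↔ IsHomQuasiIso V f := by
  rw [isHomQuasiIso_iff]
  constructor
  · intro h n m l k (hn : (ComplexShape.down ℤ).Rel n m) (hl : (ComplexShape.down ℤ).Rel m l)
      (hk : (ComplexShape.down ℤ).Rel l k) i b a hb hab
    obtain ⟨c, hc⟩ := h hn hl i (HomologicalComplex.homotopyCofiber.fstX f m l hl ≫ a +
        HomologicalComplex.homotopyCofiber.sndX f m ≫ b) (by
      apply HomologicalComplex.homotopyCofiber.ext_from_X f m n hn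
      · simp [HomologicalComplex.homotopyCofiber.inlX_d_assoc f n m l hn hl, hab]
      · simp [HomologicalComplex.homotopyCofiber.inrX_d_assoc, hb])
    refine ⟨HomologicalComplex.homotopyCofiber.inrX f l ≫ c,
      - HomologicalComplex.homotopyCofiber.inlX f k l hk ≫ c, ?_, ?_⟩
    · have := HomologicalComplex.homotopyCofiber.inrX f m ≫= hc
      simpa [HomologicalComplex.homotopyCofiber.inrX_d_assoc] using this
    · have := HomologicalComplex.homotopyCofiber.inlX f l m hl ≫= hc
      simp [HomologicalComplex.homotopyCofiber.inlX_d_assoc f m l k hl hk] at this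
      rw [← this]
      simp [add_comm]
  · intro h n m l (hn : (ComplexShape.down ℤ).Rel n m) (hl : (ComplexShape.down ℤ).Rel m l) i φ hφ
    have hb := HomologicalComplex.homotopyCofiber.inrX f n ≫= hφ
    have ha := HomologicalComplex.homotopyCofiber.inlX f m n hn ≫= hφ
    simp [HomologicalComplex.homotopyCofiber.inrX_d_assoc] at hb
    simp [HomologicalComplex.homotopyCofiber.inlX_d_assoc f n m l hn hl] at ha
    have hk : (ComplexShape.down ℤ).Rel l (l - 1) := by simp
    obtain ⟨b', a', hb', ha'⟩ := h hn hl hk i _ _ hb (neg_add_eq_zero.1 ha).symm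
    refine ⟨HomologicalComplex.homotopyCofiber.sndX f l ≫ b' -
      HomologicalComplex.homotopyCofiber.fstX f l (l - 1) hk ≫ a', ?_⟩
    apply HomologicalComplex.homotopyCofiber.ext_from_X f l m hl
    · simp [HomologicalComplex.homotopyCofiber.inlX_d_assoc f m l (l - 1) hl hk, ha']
    · simp [HomologicalComplex.homotopyCofiber.inrX_d_assoc, hb']

variable [HasKernels C] [HasCokernels C] [HasProducts.{v} C] {V : ι → C}
  (hV : IsInjectiveCogenerator V)
include hV

lemma IsInjectiveCogenerator.isStrictlyAcyclic_iff (K : ChainComplex C ℤ) :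
    IsStrictlyAcyclic K ↔ ∀ {n m l : ℤ} (_ : m + 1 = n) (_ : l + 1 = m),
      HomExact V (K.d n m) (K.d m l) := by
  constructor
  · intro h n m l hn hl
    have h' (a b c : ℤ) (_ : b + 1 = a) (_ : c + 1 = b) :
        IsIso (coimageToKernel (K.d a b) (K.d b c) (K.d_comp_d _ _ _)) := by
      obtain rfl : b = a - 1 := by lia
      obtain rfl : c = a - 2 := by lia
      exact h a
    exact hV.homExact _ _ (h' n m l hn hl) (h' m l (l - 1) hl (by simp))
  · intro h i
    exact hV.isIso_coimageToKernel (K.d_comp_d (i + 1) i (i - 1)) _ (h rfl (by simp))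
      (h (by simp) (by lia))

lemma IsInjectiveCogenerator.strictQuasiIso_eq [HasBinaryBiproducts C] :
    strictQuasiIso C = homQuasiIso C V := by
  ext K L f
  exact (hV.isStrictlyAcyclic_iff _).trans (forall_homExact_homotopyCofiber_iff V f)

lemma IsInjectiveCogenerator.levelwiseStrictMono_iff {K L : ChainComplex C ℤ} (f : K ⟶ L) :
    levelwiseStrictMono C f ↔ ∀ m, hasExtensions V (f.f m) :=
  forall_congr' fun _ => hV.mono_and_isStrict_iff _

end QuasiIso

/-! ### Lifting properties -/

section Lifting

variable {C : Type u} [Category.{v} C] [Preadditive C] [HasZeroObject C]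

namespace HomologicalComplex

open scoped Classical in
/-- Constructor for morphisms to the complex `double (𝟙 V)`. -/
noncomputable def mkHomToDoubleId {K : HomologicalComplex C (ComplexShape.down ℤ)} {V : C}
    {m l : ℤ} (hl : (ComplexShape.down ℤ).Rel m l) (a : K.X l ⟶ V) :
    K ⟶ double (𝟙 V) hl where
  f k :=
    if hk₀ : k = m then
      eqToHom (by rw [hk₀]) ≫ K.d m l ≫ a ≫ (doubleXIso₀ (𝟙 V) hl).inv ≫ eqToHom (by rw [hk₀])
    else if hk₁ : k = l then
      eqToHom (by rw [hk₁]) ≫ a ≫ (doubleXIso₁ (𝟙 V) hl (by rintro rfl; simp at hl)).inv ≫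
        eqToHom (by rw [hk₁])
    else 0
  comm' k₀ k₁ hk := by
    have hml : m ≠ l := by rintro rfl; simp at hl
    by_cases h₁ : k₁ = l
    · subst h₁
      obtain rfl := (ComplexShape.down ℤ).prev_eq hk hl
      simp [dif_neg hml.symm, double_d (𝟙 V) hl hml]
    · by_cases h₀ : k₁ = m
      · subst h₀
        have h : k₀ ≠ k₁ := by rintro rfl; simp at hk
        have h' : k₀ ≠ l := by rintro rfl; simp at hk hl; lia
        simp [h, h']
      · apply (isZero_double_X _ hl k₁ h₀ h₁).eq_of_tgt

variable {K : HomologicalComplex C (ComplexShape.down ℤ)} {V : C} {m l : ℤ}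
  (hl : (ComplexShape.down ℤ).Rel m l)

@[simp]
lemma mkHomToDoubleId_f₀ (a : K.X l ⟶ V) :
    (mkHomToDoubleId hl a).f m = K.d m l ≫ a ≫ (doubleXIso₀ _ hl).inv := by
  simp [mkHomToDoubleId]

@[simp]
lemma mkHomToDoubleId_f₁ (a : K.X l ⟶ V) (h : m ≠ l) :
    (mkHomToDoubleId hl a).f l = a ≫ (doubleXIso₁ (𝟙 V) hl h).inv := by
  simp [mkHomToDoubleId, h.symm]

end HomologicalComplex
open HomologicalComplex

@[simp]
lemma shiftedConeProj_f (V : C) (m : ℤ) :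
    (shiftedConeProj V m).f m = (doubleXIso₀ (𝟙 V) _).hom ≫ (singleObjXSelf _ m V).inv := by
  simp [shiftedConeProj]

lemma shiftedCone_d (V : C) (m : ℤ) :
    (shiftedCone V m).d m (m - 1) =
      (doubleXIso₀ (𝟙 V) _).hom ≫ (doubleXIso₁ (𝟙 V) _ (by lia)).inv := by
  rw [double_d _ _ (by lia), Category.id_comp]

lemma to_shiftedCone_ext {K : ChainComplex C ℤ} {V : C} {m : ℤ} {f g : K ⟶ shiftedCone V m}
    (h : f.f (m - 1) = g.f (m - 1)) : f = g := by
  apply to_double_hom_ext _ h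
  have := f.comm m (m - 1)
  rw [h, ← g.comm, shiftedCone_d] at this
  simpa using this

lemma shiftedCone_comp_d {K : ChainComplex C ℤ} {V : C} {m : ℤ} (f : K ⟶ shiftedCone V m) :
    f.f m ≫ (doubleXIso₀ (𝟙 V) _).hom =
      K.d m (m - 1) ≫ f.f (m - 1) ≫ (doubleXIso₁ (𝟙 V) _ (by lia)).hom := by
  rw [← f.comm_assoc, shiftedCone_d]
  simp

/-- The cone represents the functor sending `K` to the maps from `K.X (m - 1)` to `V`, via
`mkHomToDoubleId` and `to_shiftedCone_ext`. -/
lemma hasLiftingProperty_shiftedCone_iff {K L : ChainComplex C ℤ} (f : K ⟶ L) (V : C) (m : ℤ) :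
    HasLiftingProperty f (0 : shiftedCone V m ⟶ 0) ↔
      ∀ a : K.X (m - 1) ⟶ V, ∃ b, f.f (m - 1) ≫ b = a := by
  have hm : m ≠ m - 1 := by lia
  constructor
  · intro _ a
    have sq : CommSq (mkHomToDoubleId _ a) f (0 : shiftedCone V m ⟶ 0) 0 := ⟨by simp⟩
    refine ⟨sq.lift.f (m - 1) ≫ (doubleXIso₁ (𝟙 V) _ hm).hom, ?_⟩
    rw [← comp_f_assoc, sq.fac_left, mkHomToDoubleId_f₁ _ _ hm]
    simp
  · intro h
    refine ⟨fun {t b} sq => ?_⟩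
    obtain ⟨b, hb⟩ := h (t.f (m - 1) ≫ (doubleXIso₁ (𝟙 V) _ hm).hom)
    exact ⟨⟨{ l := mkHomToDoubleId _ b
              fac_left := to_shiftedCone_ext (by
                rw [comp_f, mkHomToDoubleId_f₁ _ _ hm, reassoc_of% hb]
                simp)
              fac_right := (isZero_zero _).eq_of_tgt _ _ }⟩⟩

lemma hasLiftingProperty_shiftedConeProj_iff {K L : ChainComplex C ℤ} (f : K ⟶ L) (V : C) (m : ℤ) :
    HasLiftingProperty f (shiftedConeProj V m) ↔
      ∀ (b : L.X m ⟶ V) (a : K.X (m - 1) ⟶ V) (_ : L.d (m + 1) m ≫ b = 0)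
        (_ : f.f m ≫ b = K.d m (m - 1) ≫ a), ∃ b' : L.X (m - 1) ⟶ V,
          L.d m (m - 1) ≫ b' = b ∧ a = f.f (m - 1) ≫ b' := by
  have hm : m ≠ m - 1 := by lia
  constructor
  · intro _ b a hb hab
    have sq : CommSq (mkHomToDoubleId _ a) f (shiftedConeProj V m)
        (mkHomToSingle b (by rintro j rfl; exact hb)) := ⟨by
      ext
      simp [reassoc_of% hab]⟩
    refine ⟨sq.lift.f (m - 1) ≫ (doubleXIso₁ (𝟙 V) _ hm).hom, ?_, ?_⟩
    · rw [← shiftedCone_comp_d]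
      have := congr_arg (fun φ => φ.f m) sq.fac_right
      rw [comp_f, shiftedConeProj_f, mkHomToSingle_f, ← Category.assoc] at this
      exact (cancel_mono _).1 this
    · rw [← comp_f_assoc, sq.fac_left, mkHomToDoubleId_f₁ _ _ hm]
      simp
  · intro h
    refine ⟨fun {t b} sq => ?_⟩
    obtain ⟨b', hb', ha⟩ := h (b.f m ≫ (singleObjXSelf _ m V).hom)
        (t.f (m - 1) ≫ (doubleXIso₁ (𝟙 V) _ hm).hom) (by rw [← b.comm_assoc]; simp) (by
      rw [← shiftedCone_comp_d, ← comp_f_assoc, ← sq.w]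
      simp)
    exact ⟨⟨{ l := mkHomToDoubleId _ b'
              fac_left := to_shiftedCone_ext (by
                rw [comp_f, mkHomToDoubleId_f₁ _ _ hm, ← reassoc_of% ha]
                simp)
              fac_right := to_single_hom_ext (by simp [reassoc_of% hb']) }⟩⟩

variable {ι : Type*} (V : ι → C)

/-- The morphisms `cone(V i)[n] ⟶ V i[n - 1]`. -/
noncomputable def conesProj : MorphismProperty (ChainComplex C ℤ) :=
  .ofHoms fun p : ι × ℤ => shiftedConeProj (V p.1) (1 - p.2)

/-- The morphisms `cone(V i)[n] ⟶ 0`. -/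
noncomputable def conesToZero : MorphismProperty (ChainComplex C ℤ) :=
  .ofHoms fun p : ι × ℤ => (0 : shiftedCone (V p.1) (1 - p.2) ⟶ 0)

lemma conesProj_mem (i : ι) (m : ℤ) : conesProj V (shiftedConeProj (V i) m) := by
  obtain ⟨n, rfl⟩ : ∃ n, m = 1 - n := ⟨1 - m, by simp⟩
  exact ⟨(i, n)⟩

lemma conesToZero_mem (i : ι) (m : ℤ) : conesToZero V (0 : shiftedCone (V i) m ⟶ 0) := by
  obtain ⟨n, rfl⟩ : ∃ n, m = 1 - n := ⟨1 - m, by simp⟩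
  exact ⟨(i, n)⟩

lemma conesToZero_llp_iff {K L : ChainComplex C ℤ} (f : K ⟶ L) :
    (conesToZero V).llp f ↔ ∀ m, hasExtensions V (f.f m) := by
  constructor
  · intro h m i
    have := (hasLiftingProperty_shiftedCone_iff f (V i) (m + 1)).1 (h _ (conesToZero_mem V i _))
    rwa [add_sub_cancel_right] at this
  · rintro h _ _ _ ⟨i, n⟩
    exact (hasLiftingProperty_shiftedCone_iff f (V i) _).2 (h _ i)

lemma conesProj_llp_iff {K L : ChainComplex C ℤ} (f : K ⟶ L) :
    (conesProj V).llp f ↔ ∀ {n m l : ℤ} (_ : m + 1 = n) (_ : l + 1 = m) (i : ι)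
      (b : L.X m ⟶ V i) (a : K.X l ⟶ V i) (_ : L.d n m ≫ b = 0)
      (_ : f.f m ≫ b = K.d m l ≫ a), ∃ b' : L.X l ⟶ V i,
        L.d m l ≫ b' = b ∧ a = f.f l ≫ b' := by
  constructor
  · intro h n m l hn hl i
    obtain rfl : l = m - 1 := by lia
    subst hn
    exact (hasLiftingProperty_shiftedConeProj_iff f (V i) m).1 (h _ (conesProj_mem V i m))
  · rintro h _ _ _ ⟨i, n⟩
    exact (hasLiftingProperty_shiftedConeProj_iff f (V i) _).2 (h rfl (by lia) i)

/-- Lifting against `P` is the condition of `isHomQuasiIso_iff` with the correction term `a'` equal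
to zero; degreewise extension is exactly what allows `a'` to be absorbed. -/
lemma conesProj_llp_eq :
    (conesProj V).llp = (conesToZero V).llp ⊓ homQuasiIso C V := by
  ext K L f
  change _ ↔ (conesToZero V).llp f ∧ IsHomQuasiIso V f
  rw [conesProj_llp_iff, conesToZero_llp_iff, isHomQuasiIso_iff]
  constructor
  · refine fun h => ⟨fun m i a => ?_, fun {n m l k} hn hl hk i b a hb hab => ?_⟩
    -- To extend `a`, its coboundary is first extended to a cocycle `b'` on `L`; the second lift
    -- then extends `a` itself with coboundary `b'`.
    · obtain ⟨b', hb', ha⟩ := h rfl rfl i (0 : L.X (m + 1 + 1) ⟶ V i) (K.d (m + 1) m ≫ a)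
        (by simp) (by simp)
      obtain ⟨b, _, hb⟩ := h rfl rfl i b' a hb' ha.symm
      exact ⟨b, hb.symm⟩
    · obtain ⟨b', hb', ha⟩ := h hn hl i b a hb hab
      exact ⟨b', 0, hb', by simp [ha]⟩
  · rintro ⟨h, hf⟩ n m l hn hl i b a hb hab
    obtain ⟨b', a', hb', ha⟩ := hf hn hl (k := l - 1) (by simp) i b a hb hab
    obtain ⟨c, rfl⟩ := h (l - 1) i a'
    exact ⟨b' + L.d l (l - 1) ≫ c, by simp [hb'], by simp [ha]⟩

/-- Such an `f` is a homotopy equivalence. Lifting against `0 ⟶ L` gives a section `s`; lifting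
against the inclusion of `K` into its cone extends `𝟙 K - f ≫ s` over the cone, so it is
null-homotopic. -/
lemma conesToZero_llp_rlp_le [HasBinaryBiproducts C] :
    (conesToZero V).llp.rlp ≤ homQuasiIso C V := by
  intro K L f hf
  have hs : (conesToZero V).llp (0 : 0 ⟶ L) := by
    rw [conesToZero_llp_iff]
    refine fun m i a => ⟨0, ?_⟩
    have : IsZero ((0 : ChainComplex C ℤ).X m) :=
      (eval C (ComplexShape.down ℤ) m).map_isZero (isZero_zero _)
    exact this.eq_of_src _ _
  have := hf _ hs
  have sq : CommSq (0 : 0 ⟶ K) (0 : 0 ⟶ L) f (𝟙 L) := ⟨by simp⟩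
  obtain ⟨s, hs⟩ : ∃ s : L ⟶ K, s ≫ f = 𝟙 L := ⟨sq.lift, sq.fac_right⟩
  have hinr : (conesToZero V).llp (homotopyCofiber.inr (𝟙 K)) := by
    rw [conesToZero_llp_iff]
    exact fun m i a => ⟨homotopyCofiber.sndX (𝟙 K) m ≫ a, homotopyCofiber.inrX_sndX_assoc _ _ _⟩
  have := hf _ hinr
  have sq' : CommSq (𝟙 K - f ≫ s) (homotopyCofiber.inr (𝟙 K)) f 0 := ⟨by simp [hs]⟩
  have h : Homotopy (𝟙 K - f ≫ s) 0 :=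
    (Homotopy.ofEq (by simp [sq'.fac_left])).trans
      (((homotopyCofiber.inrCompHomotopy (𝟙 K) (fun j => ⟨j + 1, rfl⟩)).compRight
        sq'.lift).trans (Homotopy.ofEq (by simp)))
  have key {n m l : ℤ} (hn : m + 1 = n) (hl : l + 1 = m) (i : ι) (a : K.X m ⟶ V i)
      (ha : K.d n m ≫ a = 0) : a = f.f m ≫ s.f m ≫ a + K.d m l ≫ h.hom l m ≫ a := by
    have := h.comm m
    rw [dNext_eq h.hom (show (ComplexShape.down ℤ).Rel m l from hl),
      prevD_eq h.hom (show (ComplexShape.down ℤ).Rel n m from hn)] at this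
    have := this =≫ a
    simp only [sub_f_apply, id_f, comp_f, zero_f, add_zero, Preadditive.sub_comp,
      Preadditive.add_comp, Category.id_comp, Category.assoc, ha, comp_zero] at this
    rw [← this]
    abel
  refine ⟨fun {n m l} hn hl i a ha => ⟨s.f m ≫ a, h.hom l m ≫ a, ?_, key hn hl i a ha⟩,
    fun {n m l} hn hl i b hb a hab => ⟨s.f l ≫ a, ?_⟩⟩
  · rw [← s.comm_assoc, ha, comp_zero]
  · rw [← s.comm_assoc, ← hab, ← comp_f_assoc, hs, id_f, Category.id_comp]

end Lifting

/-! ### The small object argument -/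

section SmallObjectArgument

universe w

variable {D : Type u} [Category.{v} D]

/-- A version of the small object argument for countable sequences, where the successor step does
not need to be functorial and the class `I` does not need to be small. -/
lemma exists_transfiniteCompositions_rlp_factorization [HasColimitsOfShape ℕ D]
    (I J : MorphismProperty D)
    (hI : ∀ {A B : D} (i : A ⟶ B), I i →
      ∀ F : ℕ ⥤ D, PreservesColimit F (coyoneda.obj (Opposite.op A)))
    (step : ∀ {Y X : D} (g : Y ⟶ X), ∃ (Y' : D) (j : Y ⟶ Y') (g' : Y' ⟶ X), J j ∧ j ≫ g' = g ∧
      ∀ {A B : D} (i : A ⟶ B), I i → ∀ (t : A ⟶ Y) (b : B ⟶ X), t ≫ g = i ≫ b →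
        ∃ l : B ⟶ Y', i ≫ l = t ≫ j ∧ l ≫ g' = b)
    {Y X : D} (g : Y ⟶ X) :
    ∃ (Z : D) (p : Y ⟶ Z) (q : Z ⟶ X),
      MorphismProperty.transfiniteCompositions.{w} J p ∧ I.rlp q ∧ p ≫ q = g := by
  choose Y' j g' hj fac lift using @step
  let obj : ℕ → Over X := fun n => Nat.rec (Over.mk g) (fun _ Y => Over.mk (g' Y.hom)) n
  let map (n : ℕ) : obj n ⟶ obj (n + 1) := Over.homMk (j (obj n).hom) (fac _)
  let F' : ℕ ⥤ Over X := Functor.ofSequence map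
  let F : ℕ ⥤ D := F' ⋙ Over.forget X
  have hF (n : ℕ) : F.map (homOfLE (Nat.le_add_right n 1)) = j (obj n).hom :=
    congr_arg (fun f => f.left) (Functor.ofSequence_map_homOfLE_succ map n)
  let q : colimit F ⟶ X := colimit.desc F ((Over.forgetCocone X).whisker F')
  have hq (n : ℕ) : colimit.ι F n ≫ q = (obj n).hom := colimit.ι_desc _ _
  refine ⟨colimit F, colimit.ι F 0, q, ?_, ?_, hq 0⟩
  · let h : J.TransfiniteCompositionOfShape ℕ (colimit.ι F 0) :=
      { F := F
        isoBot := Iso.refl _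
        incl := (colimit.cocone F).ι
        isColimit := colimit.isColimit F
        fac := Category.id_comp _
        map_mem n _ := by
          change J (F.map (homOfLE (Nat.le_add_right n 1)))
          rw [hF]
          exact hj _ }
    -- The indexing order has to live in the universe `w`, hence the shrunk copy of `ℕ`.
    exact J.transfiniteCompositionsOfShape_le_transfiniteCompositions _ _
      (h.ofOrderIso (orderIsoShrink.{w} ℕ).symm).mem
  · intro A B i hi
    refine ⟨fun {t b} sq => ?_⟩
    -- By smallness `t` factors through a finite stage `n`, and the lifting problem is solved at
    -- stage `n + 1`.
    have := hI i hi F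
    obtain ⟨n, t', ht'⟩ := exists_hom_of_preservesColimit_coyoneda (colimit.isColimit F) t
    obtain ⟨l, hl, hl'⟩ := lift (obj n).hom i hi t' b (by
      rw [← hq, ← sq.w, ← ht', Category.assoc]
      rfl)
    change B ⟶ F.obj (n + 1) at l
    replace hl : i ≫ l = t' ≫ F.map (homOfLE (Nat.le_add_right n 1)) :=
      hl.trans (congr_arg (t' ≫ ·) (hF n).symm)
    refine ⟨⟨{ l := l ≫ colimit.ι F (n + 1), fac_left := ?_, fac_right := ?_ }⟩⟩
    · rw [reassoc_of% hl, colimit.w, ← ht']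
      rfl
    · rw [Category.assoc, hq]
      exact hl'

end SmallObjectArgument

/-! ### Cocell complexes and the dual small object argument -/

section Cocell

variable {C : Type u} [Category.{v} C]

/-- Base changes of small products of morphisms in `P`. -/
def pullbacksProducts (P : MorphismProperty C) : MorphismProperty C :=
  (MorphismProperty.coproducts.{v} P.op).pushouts.unop

lemma pullbacksProducts_of_isPullback (P : MorphismProperty C) {K : Type v} {A B : K → C}
    {a : Fan A} (ha : IsLimit a) {b : Fan B} (hb : IsLimit b)
    (p : ∀ k, A k ⟶ B k) (hp : ∀ k, P (p k)) {q : a.pt ⟶ b.pt}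
    (hq : ∀ k, q ≫ b.proj k = a.proj k ≫ p k)
    {X Y : C} {t : X ⟶ a.pt} {f : X ⟶ Y} {s : Y ⟶ b.pt}
    (sq : IsPullback t f q s) : pullbacksProducts P f := by
  refine MorphismProperty.pushouts_mk _ sq.op ?_
  refine MorphismProperty.colimitsOfShape_le_coproducts _ K _ ?_
  exact MorphismProperty.colimitsOfShape.mk' _ _ _ _ (Fan.IsLimit.op hb) (Fan.IsLimit.op ha)
    (Discrete.natTrans fun k => (p k.as).op) (fun k => hp k.as) _
    (fun k => Quiver.Hom.unop_inj (hq k.as))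

lemma retractsCocell_le_llp_rlp (P : MorphismProperty C) : retractsCocell P ≤ P.llp.rlp := by
  intro X Y f hf A B g hg
  have h := MorphismProperty.retracts_transfiniteComposition_pushouts_coproducts_le_llp_rlp.{v}
    P.op _ hf
  exact (h g.op fun _ _ p hp => (hg _ hp).op).unop

/-- Transfinite inverse compositions of base changes of small products of morphisms in `P`. -/
def cocell (P : MorphismProperty C) : MorphismProperty C :=
  (MorphismProperty.transfiniteCompositions.{v} (pullbacksProducts P).op).unop

lemma pullbacksProducts_le_cocell (P : MorphismProperty C) : pullbacksProducts P ≤ cocell P :=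
  fun _ _ _ hf => MorphismProperty.le_transfiniteCompositions _ _ hf

lemma llp_rlp_eq_retractsCocell (P : MorphismProperty C)
    (h : ∀ {X Y : C} (f : X ⟶ Y), ∃ (Z : C) (i : X ⟶ Z) (p : Z ⟶ Y),
      P.llp i ∧ cocell P p ∧ i ≫ p = f) :
    P.llp.rlp = retractsCocell P := by
  refine le_antisymm (fun X Y f hf => ?_) (retractsCocell_le_llp_rlp P)
  obtain ⟨Z, i, p, hi, hp, fac⟩ := h f
  have := hf i hi
  exact ⟨_, _, _, (RetractArrow.ofRightLiftingProperty fac).op, hp⟩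

lemma cocell_le_llp_rlp (P : MorphismProperty C) : cocell P ≤ P.llp.rlp :=
  fun _ _ _ hf => retractsCocell_le_llp_rlp P _ (MorphismProperty.le_retracts _ _ hf)

/-- The small object argument in the opposite category. -/
lemma exists_llp_cocell_factorization [HasLimitsOfShape ℕᵒᵖ C] (P : MorphismProperty C)
    (hP : ∀ {A B : C} (p : A ⟶ B), P p →
      ∀ F : ℕ ⥤ Cᵒᵖ, PreservesColimit F (coyoneda.obj (Opposite.op (Opposite.op B))))
    (step : ∀ {X Y : C} (g : X ⟶ Y), ∃ (Y' : C) (g' : X ⟶ Y') (j : Y' ⟶ Y),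
      pullbacksProducts P j ∧ g' ≫ j = g ∧
      ∀ {A B : C} (p : A ⟶ B), P p → ∀ (t : X ⟶ A) (b : Y ⟶ B), t ≫ p = g ≫ b →
        ∃ l : Y' ⟶ A, l ≫ p = j ≫ b ∧ g' ≫ l = t)
    {X Y : C} (f : X ⟶ Y) : ∃ (Z : C) (i : X ⟶ Z) (p : Z ⟶ Y),
      P.llp i ∧ cocell P p ∧ i ≫ p = f := by
  have : HasColimitsOfShape ℕ Cᵒᵖ := hasColimitsOfShape_op_of_hasLimitsOfShape
  obtain ⟨Z, p, q, hp, hq, fac⟩ := exists_transfiniteCompositions_rlp_factorization.{v}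
    P.op (pullbacksProducts P).op (fun i hi F => hP i.unop hi F) (fun {Y X} g => by
      obtain ⟨Y', g', j, hj, hg, H⟩ := step g.unop
      refine ⟨Opposite.op Y', j.op, g'.op, hj, congr_arg Quiver.Hom.op hg,
        fun i hi t b h => ?_⟩
      obtain ⟨l, hl, hl'⟩ := H i.unop hi b.unop t.unop (congr_arg Quiver.Hom.unop h.symm)
      exact ⟨l.op, congr_arg Quiver.Hom.op hl, congr_arg Quiver.Hom.op hl'⟩) f.op
  exact ⟨Z.unop, q.unop, p.unop, fun A B g hg => (hq g.op hg).unop,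
    hp, congr_arg Quiver.Hom.unop fac⟩

end Cocell

/-! ### Cosmall complexes -/

section Cosmall

variable {C : Type u} [Category.{v} C]

lemma isPresentable_of_isZero {X : C} (hX : IsZero X) : IsPresentable.{v} X := by
  have : Fact Cardinal.aleph0.{v}.IsRegular := Cardinal.fact_isRegular_aleph0
  have : IsCardinalPresentable X Cardinal.aleph0.{v} :=
    { preservesColimitOfShape J _ _ := ⟨fun {F} => ⟨fun {c} hc => ⟨by
        have := isFiltered_of_isCardinalFiltered J Cardinal.aleph0.{v}
        exact Types.FilteredColimit.isColimitOf' _ _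
          (fun _ => ⟨IsFiltered.nonempty.some, hX.to_ _, hX.eq_of_src _ _⟩)
          (fun j _ _ _ => ⟨j, 𝟙 j, hX.eq_of_src _ _⟩)⟩⟩⟩ }
  exact isPresentable_of_isCardinalPresentable _ Cardinal.aleph0.{v}

variable [Preadditive C] [HasZeroObject C]

lemma preservesColimitsOfShape_coyoneda_op_single {J : Type*} [Category* J] [IsFiltered J]
    [HasLimitsOfShape Jᵒᵖ C] (V : C)
    [PreservesColimitsOfShape J (coyoneda.obj (Opposite.op (Opposite.op V)))] (m : ℤ) :
    PreservesColimitsOfShape J (coyoneda.obj (Opposite.op (Opposite.op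
      ((HomologicalComplex.single C (ComplexShape.down ℤ) m).obj V)))) where
  preservesColimit {F} := ⟨fun {c} hc => ⟨by
    have (i : ℤ) : PreservesColimitsOfShape J
      (HomologicalComplex.eval C (ComplexShape.down ℤ) i).op := preservesColimitsOfShape_op _ _
    have hc' (i : ℤ) := isColimitOfPreserves
      (HomologicalComplex.eval C (ComplexShape.down ℤ) i).op hc
    have surj (i : ℤ) (φ : c.pt.unop.X i ⟶ V) :
        ∃ (j : J) (p : (F.obj j).unop.X i ⟶ V), (c.ι.app j).unop.f i ≫ p = φ := by
      obtain ⟨j, p, hp⟩ := exists_hom_of_preservesColimit_coyoneda (hc' i) φ.op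
      exact ⟨j, p.unop, congr_arg Quiver.Hom.unop hp⟩
    have inj (i : ℤ) {j : J} (p q : (F.obj j).unop.X i ⟶ V)
        (h : (c.ι.app j).unop.f i ≫ p = (c.ι.app j).unop.f i ≫ q) :
        ∃ (k : J) (u : j ⟶ k), (F.map u).unop.f i ≫ p = (F.map u).unop.f i ≫ q := by
      obtain ⟨k, u, hu⟩ := exists_eq_of_preservesColimit_coyoneda_self (hc' i) p.op q.op
        (congr_arg Quiver.Hom.op h)
      exact ⟨k, u, congr_arg Quiver.Hom.unop hu⟩
    apply Types.FilteredColimit.isColimitOf'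
    · intro (g : Opposite.op _ ⟶ c.pt)
      obtain ⟨j, p, hp⟩ := surj m (g.unop.f m ≫ (HomologicalComplex.singleObjXSelf _ m V).hom)
      -- At stage `j` the map `p` need not be a cocycle; its coboundary vanishes only in the limit,
      -- hence already at some later stage `k`.
      obtain ⟨k, u, hu⟩ := inj (m + 1) ((F.obj j).unop.d (m + 1) m ≫ p) 0 (by
        have := (c.ι.app j).unop.comm_assoc (m + 1) m p
        rw [this, comp_zero]
        change c.pt.unop.d _ _ ≫ _ = _
        rw [hp, ← g.unop.comm_assoc]
        simp)
      have hd (i : ℤ) (hi : (ComplexShape.down ℤ).Rel i m) :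
          (F.obj k).unop.d i m ≫ (F.map u).unop.f m ≫ p = 0 := by
        obtain rfl : m + 1 = i := hi
        rw [← (F.map u).unop.comm_assoc, hu, comp_zero]
      refine ⟨k, (HomologicalComplex.mkHomToSingle _ hd).op, ?_⟩
      · apply Quiver.Hom.unop_inj
        apply HomologicalComplex.to_single_hom_ext
        have hw : (c.ι.app k).unop.f m ≫ (F.map u).unop.f m = (c.ι.app j).unop.f m :=
          congr_arg (fun φ => φ.unop.f m) (c.w u)
        change g.unop.f m = (c.ι.app k).unop.f m ≫ HomologicalComplex.Hom.f _ m
        refine .trans ?_ (congr_arg (_ ≫ ·) (HomologicalComplex.mkHomToSingle_f _ hd).symm)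
        dsimp only
        rw [Category.assoc, reassoc_of% hw, reassoc_of% hp, Iso.hom_inv_id, Category.comp_id]
    · intro j (f : Opposite.op _ ⟶ F.obj j) (g : Opposite.op _ ⟶ F.obj j)
        (h : f ≫ c.ι.app j = g ≫ c.ι.app j)
      obtain ⟨k, u, hu⟩ := inj m (f.unop.f m ≫ (HomologicalComplex.singleObjXSelf _ m V).hom)
        (g.unop.f m ≫ (HomologicalComplex.singleObjXSelf _ m V).hom) (by
          have : (c.ι.app j).unop.f m ≫ f.unop.f m = (c.ι.app j).unop.f m ≫ g.unop.f m :=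
            congr_arg (fun φ => φ.unop.f m) h
          rw [reassoc_of% this])
      refine ⟨k, u, Quiver.Hom.unop_inj (HomologicalComplex.to_single_hom_ext ?_)⟩
      rw [← Category.assoc, ← Category.assoc] at hu
      exact (cancel_mono _).1 hu⟩⟩

lemma isPresentable_op_single [HasLimits C] (V : C)
    [IsFinitelyPresentable.{v} (Opposite.op V)] (m : ℤ) : IsPresentable.{v} (Opposite.op
      ((HomologicalComplex.single C (ComplexShape.down ℤ) m).obj V)) := by
  have : Fact Cardinal.aleph0.{v}.IsRegular := Cardinal.fact_isRegular_aleph0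
  have : IsCardinalPresentable (Opposite.op
      ((HomologicalComplex.single C (ComplexShape.down ℤ) m).obj V)) Cardinal.aleph0.{v} :=
    { preservesColimitOfShape J _ _ := by
        have := isFiltered_of_isCardinalFiltered J Cardinal.aleph0.{v}
        have := preservesColimitsOfShape_of_isCardinalPresentable (Opposite.op V)
          Cardinal.aleph0.{v} J
        exact preservesColimitsOfShape_coyoneda_op_single V m }
  exact isPresentable_of_isCardinalPresentable _ Cardinal.aleph0.{v}

end Cosmall

/-! ### Factorizations and the model structure -/

instance {C : Type u} [Category.{v} C] [Preadditive C] [HasLimits C] {ι : Type}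
    (c : ComplexShape ι) : HasLimits (HomologicalComplex C c) :=
  ⟨fun _ _ => inferInstance⟩

instance {C : Type u} [Category.{v} C] [Preadditive C] [HasColimits C] {ι : Type}
    (c : ComplexShape ι) : HasColimits (HomologicalComplex C c) :=
  ⟨fun _ _ => inferInstance⟩

lemma exists_factorization_through_pullbackProduct {C : Type u} [Category.{v} C] [HasLimits C]
    (P : MorphismProperty C) {K : Type v} {A B : K → C} (p : ∀ k, A k ⟶ B k) (hp : ∀ k, P (p k))
    {X Y : C} (f : X ⟶ Y) (t : ∀ k, X ⟶ A k) (b : ∀ k, Y ⟶ B k)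
    (w : ∀ k, t k ≫ p k = f ≫ b k) :
    ∃ (Z : C) (i : X ⟶ Z) (j : Z ⟶ Y) (τ : ∀ k, Z ⟶ A k), pullbacksProducts P j ∧ i ≫ j = f ∧
      (∀ k, i ≫ τ k = t k) ∧ ∀ k, τ k ≫ p k = j ≫ b k := by
  have w' : Pi.lift t ≫ Limits.Pi.map p = f ≫ Pi.lift b := by
    ext k
    simp [w]
  refine ⟨pullback (Limits.Pi.map p) (Pi.lift b), pullback.lift _ _ w', pullback.snd _ _,
    fun k => pullback.fst _ _ ≫ Pi.π _ k, ?_, pullback.lift_snd _ _ _, fun k => by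
    rw [pullback.lift_fst_assoc, Pi.lift_π], fun k => ?_⟩
  · exact pullbacksProducts_of_isPullback P (limit.isLimit _) (limit.isLimit _) p hp
      (q := Limits.Pi.map p) (fun k => Pi.map_π _ _) (IsPullback.of_hasPullback _ _)
  · have := (pullback.condition (f := Limits.Pi.map p) (g := Pi.lift b)) =≫ Pi.π _ k
    simpa using this

namespace IsInjectiveCogenerator

open HomologicalComplex

variable {C : Type u} [Category.{v} C] [Preadditive C] [HasLimits C]
  [HasZeroObject C] [HasKernels C]
  {ι : Type*} {V : ι → C} (hV : IsInjectiveCogenerator V)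
include hV

/-- Here `Z` is `Y` times a product of cones. Embedding each `X.X (m - 1)` in a product of objects
`V i` makes every map from it to some `V i` extend to `Z`, so no iteration is needed. -/
lemma exists_conesToZero_factorization {X Y : ChainComplex C ℤ} (f : X ⟶ Y) :
    ∃ (Z : ChainComplex C ℤ) (i : X ⟶ Z) (p : Z ⟶ Y),
      (conesToZero V).llp i ∧ pullbacksProducts (conesToZero V) p ∧ i ≫ p = f := by
  choose K k e _ he using fun m : ℤ => hV.exists_embedding (X.X (m - 1))
  obtain ⟨Z, i, p, τ, hp, fac, hτ, _⟩ := exists_factorization_through_pullbackProduct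
    (conesToZero V) (K := Σ m : ℤ, K m)
    (fun s => (0 : shiftedCone (V (k s.1 s.2)) s.1 ⟶ 0)) (fun s => conesToZero_mem V _ _) f
    (fun s => mkHomToDoubleId _ (e s.1 ≫ Pi.π _ s.2)) (fun _ => 0) (by simp)
  refine ⟨Z, i, p, ?_, hp, fac⟩
  rw [conesToZero_llp_iff]
  intro m i₀ a
  obtain ⟨m, rfl⟩ : ∃ m', m = m' - 1 := ⟨m + 1, by simp⟩
  obtain ⟨c, rfl⟩ := he m i₀ a
  have hm : m ≠ m - 1 := by lia
  refine ⟨Pi.lift (fun j => (τ ⟨m, j⟩).f (m - 1) ≫ (doubleXIso₁ (𝟙 _) _ hm).hom) ≫ c, ?_⟩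
  rw [← Category.assoc]
  congr 1
  ext j
  have := congr_arg (fun φ => φ.f (m - 1)) (hτ ⟨m, j⟩)
  dsimp only at this
  rw [comp_f, mkHomToDoubleId_f₁ _ _ hm] at this
  simp [reassoc_of% this]

variable [HasColimits C] [HasBinaryBiproducts C]

/-- The replacement for a small generating set. Squares from `f` to `shiftedConeProj (V i) m`
correspond to maps `cokernel (φ m) ⟶ V i`. Embedding this cokernel in a small product gives a small
set of squares, its coordinates, and every other square factors through their product by
injectivity. -/
lemma exists_conesProj_step {X Y : ChainComplex C ℤ} (f : X ⟶ Y) :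
    ∃ (Z : ChainComplex C ℤ) (g : X ⟶ Z) (q : Z ⟶ Y),
      pullbacksProducts (conesProj V) q ∧ g ≫ q = f ∧
      ∀ {A B : ChainComplex C ℤ} (p : A ⟶ B), conesProj V p → ∀ (t : X ⟶ A) (b : Y ⟶ B),
        t ≫ p = f ≫ b → ∃ l : Z ⟶ A, l ≫ p = q ≫ b ∧ g ≫ l = t := by
  -- A pair `(b, a)` kills `φ m` exactly when `b` is a cocycle and `f.f m ≫ b` is the coboundary of
  -- `a`.
  let φ (m : ℤ) : Y.X (m + 1) ⊞ X.X m ⟶ Y.X m ⊞ X.X (m - 1) :=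
    biprod.desc (Y.d _ _ ≫ biprod.inl) (f.f m ≫ biprod.inl - X.d _ _ ≫ biprod.inr)
  choose K k e _ he using fun m : ℤ => hV.exists_embedding (cokernel (φ m))
  have hφ₁ (m : ℤ) : Y.d (m + 1) m ≫ biprod.inl ≫ cokernel.π (φ m) = 0 := by
    simpa [φ, -cokernel.condition] using! biprod.inl ≫= cokernel.condition (φ m)
  have hφ₂ (m : ℤ) : f.f m ≫ biprod.inl ≫ cokernel.π (φ m) =
      X.d m (m - 1) ≫ biprod.inr ≫ cokernel.π (φ m) := by
    simpa [φ, sub_eq_zero, -cokernel.condition] using! biprod.inr ≫= cokernel.condition (φ m)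
  obtain ⟨Z, g, q, τ, hq, fac, hτ, hτ'⟩ := exists_factorization_through_pullbackProduct
    (conesProj V) (K := Σ m : ℤ, K m)
    (fun s => shiftedConeProj (V (k s.1 s.2)) s.1) (fun s => conesProj_mem V _ _) f
    (fun s => mkHomToDoubleId _ (biprod.inr ≫ cokernel.π (φ s.1) ≫ e s.1 ≫ Pi.π _ s.2))
    (fun s => mkHomToSingle (biprod.inl ≫ cokernel.π (φ s.1) ≫ e s.1 ≫ Pi.π _ s.2) (by
      rintro _ rfl
      simp only [reassoc_of% hφ₁ s.1, zero_comp])) (fun s => by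
        apply to_single_hom_ext
        simp [reassoc_of% hφ₂ s.1])
  refine ⟨Z, g, q, hq, fac, ?_⟩
  suffices H : ∀ (i : ι) (m : ℤ) (t : X ⟶ shiftedCone (V i) m) (b : Y ⟶ (single _ _ m).obj (V i)),
      t ≫ shiftedConeProj _ _ = f ≫ b →
        ∃ l : Z ⟶ shiftedCone (V i) m, l ≫ shiftedConeProj _ _ = q ≫ b ∧ g ≫ l = t by
    rintro _ _ _ ⟨i, n⟩
    exact H i _
  intro i m t b w
  have hm : m ≠ m - 1 := by lia
  let t₁ := t.f (m - 1) ≫ (doubleXIso₁ (𝟙 _) _ hm).hom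
  let b₁ := b.f m ≫ (singleObjXSelf _ m (V i)).hom
  have hb₁ : Y.d (m + 1) m ≫ b₁ = 0 := by
    dsimp only [b₁]
    rw [← b.comm_assoc]
    simp
  have htb : f.f m ≫ b₁ = X.d m (m - 1) ≫ t₁ := by
    dsimp only [b₁, t₁]
    rw [← shiftedCone_comp_d, ← comp_f_assoc, ← w]
    simp
  obtain ⟨c, hc⟩ := he m i (cokernel.desc (φ m) (biprod.desc b₁ t₁) (by
    ext <;> simp [φ, hb₁, htb]))
  have hc₁ : biprod.inl ≫ cokernel.π (φ m) ≫ e m ≫ c = b₁ := by rw [hc]; simp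
  have hc₂ : biprod.inr ≫ cokernel.π (φ m) ≫ e m ≫ c = t₁ := by rw [hc]; simp
  let l₁ : Z.X (m - 1) ⟶ V i :=
    Pi.lift (fun j => (τ ⟨m, j⟩).f (m - 1) ≫ (doubleXIso₁ (𝟙 _) _ hm).hom) ≫ c
  have hl₁ : g.f (m - 1) ≫ l₁ = t₁ := by
    rw [← hc₂, ← Category.assoc, ← Category.assoc, ← Category.assoc]
    congr 1
    ext j
    have := congr_arg (fun φ => φ.f (m - 1)) (hτ ⟨m, j⟩)
    dsimp only at this
    rw [comp_f, mkHomToDoubleId_f₁ _ _ hm] at this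
    simp [reassoc_of% this]
  have hl₂ : Z.d m (m - 1) ≫ l₁ = q.f m ≫ b₁ := by
    rw [← hc₁, ← Category.assoc, ← Category.assoc, ← Category.assoc, ← Category.assoc]
    congr 1
    ext j
    have := congr_arg (fun φ => φ.f m ≫ (singleObjXSelf _ m _).hom) (hτ' ⟨m, j⟩)
    simp at this
    rw [shiftedCone_comp_d] at this
    simpa using this
  refine ⟨mkHomToDoubleId _ l₁, to_single_hom_ext ?_, to_shiftedCone_ext ?_⟩
  · dsimp only [b₁] at hl₂
    simp [reassoc_of% hl₂]
  · rw [comp_f, mkHomToDoubleId_f₁ _ _ hm, reassoc_of% hl₁]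
    simp [t₁]

variable [∀ i, IsFinitelyPresentable.{v} (Opposite.op (V i))]

lemma exists_conesProj_factorization {X Y : ChainComplex C ℤ} (f : X ⟶ Y) :
    ∃ (Z : ChainComplex C ℤ) (i : X ⟶ Z) (p : Z ⟶ Y),
      (conesProj V).llp i ∧ cocell (conesProj V) p ∧ i ≫ p = f := by
  refine exists_llp_cocell_factorization _ ?_ hV.exists_conesProj_step f
  rintro _ _ _ ⟨i, n⟩ F
  have : Fact Cardinal.aleph0.{v}.IsRegular := Cardinal.fact_isRegular_aleph0
  have : IsCardinalFiltered ℕ Cardinal.aleph0.{v} := by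
    rw [isCardinalFiltered_aleph0_iff]
    infer_instance
  have : PreservesColimitsOfShape ℕ (coyoneda.obj (Opposite.op (Opposite.op (V i)))) :=
    preservesColimitsOfShape_of_isCardinalPresentable_of_essentiallySmall _ Cardinal.aleph0.{v} ℕ
  have := preservesColimitsOfShape_coyoneda_op_single (J := ℕ) (V i) (1 - n)
  infer_instance

lemma exists_modelCategory :
    ∃ _ : ModelCategory (ChainComplex C ℤ),
      IsFibrantlyCogenerated (ChainComplex C ℤ) (conesProj V) (conesToZero V) ∧
      weakEquivalences (ChainComplex C ℤ) = strictQuasiIso C ∧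
      cofibrations (ChainComplex C ℤ) = levelwiseStrictMono C := by
  let _ : CategoryWithCofibrations (ChainComplex C ℤ) := ⟨levelwiseStrictMono C⟩
  let _ : CategoryWithWeakEquivalences (ChainComplex C ℤ) := ⟨strictQuasiIso C⟩
  let _ : CategoryWithFibrations (ChainComplex C ℤ) := ⟨(conesProj V).llp.rlp⟩
  have hW : weakEquivalences (ChainComplex C ℤ) = homQuasiIso C V := hV.strictQuasiIso_eq
  have hCof : cofibrations (ChainComplex C ℤ) = (conesToZero V).llp := by
    ext K L f
    exact (hV.levelwiseStrictMono_iff f).trans (conesToZero_llp_iff V f).symm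
  have hTrivCof : trivialCofibrations (ChainComplex C ℤ) = (conesProj V).llp := by
    rw [trivialCofibrations, hW, hCof, conesProj_llp_eq]
  have hFib : fibrations (ChainComplex C ℤ) = (conesProj V).llp.rlp := rfl
  have hle : (conesToZero V).llp.rlp ≤ (conesProj V).llp.rlp :=
    MorphismProperty.antitone_rlp (by rw [conesProj_llp_eq]; exact inf_le_left)
  have : (homQuasiIso C V).HasTwoOutOfThreeProperty := inferInstance
  have hTrivFib : trivialFibrations (ChainComplex C ℤ) = (conesToZero V).llp.rlp := by
    rw [trivialFibrations, hW, hFib]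
    refine le_antisymm ?_ (le_inf hle (conesToZero_llp_rlp_le V))
    -- Retract argument: by two-out-of-three `i` is a trivial cofibration, so it lifts against `f`,
    -- and `f` is a retract of `p`.
    rintro X Y f ⟨hf, hf'⟩
    obtain ⟨Z, i, p, hi, hp, rfl⟩ := hV.exists_conesToZero_factorization f
    replace hp := cocell_le_llp_rlp _ _ (pullbacksProducts_le_cocell _ _ hp)
    have hi' : (conesProj V).llp i := by
      rw [conesProj_llp_eq]
      exact ⟨hi, MorphismProperty.of_postcomp _ _ _ (conesToZero_llp_rlp_le V _ hp) hf'⟩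
    have := hf i hi'
    exact MorphismProperty.of_retract (RetractArrow.ofRightLiftingProperty rfl) hp
  have : (weakEquivalences (ChainComplex C ℤ)).HasTwoOutOfThreeProperty := by rwa [hW]
  have : MorphismProperty.IsWeakFactorizationSystem (cofibrations (ChainComplex C ℤ))
      (trivialFibrations (ChainComplex C ℤ)) := by
    have : MorphismProperty.HasFactorization (conesToZero V).llp (conesToZero V).llp.rlp :=
      ⟨fun f => by
        obtain ⟨Z, i, p, hi, hp, fac⟩ := hV.exists_conesToZero_factorization f
        exact ⟨⟨Z, i, p, fac, hi,
          cocell_le_llp_rlp _ _ (pullbacksProducts_le_cocell _ _ hp)⟩⟩⟩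
    rw [hCof, hTrivFib]
    exact .mk' _ _ fun i p hi hp => hp i hi
  have : MorphismProperty.IsWeakFactorizationSystem (trivialCofibrations (ChainComplex C ℤ))
      (fibrations (ChainComplex C ℤ)) := by
    have : MorphismProperty.HasFactorization (conesProj V).llp (conesProj V).llp.rlp :=
      ⟨fun f => by
        obtain ⟨Z, i, p, hi, hp, fac⟩ := hV.exists_conesProj_factorization f
        exact ⟨⟨Z, i, p, fac, hi, cocell_le_llp_rlp _ _ hp⟩⟩⟩
    rw [hTrivCof, hFib]
    exact .mk' _ _ fun i p hi hp => hp i hi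
  let M : ModelCategory (ChainComplex C ℤ) := ModelCategory.mk' _
  refine ⟨M, ⟨hTrivCof, hCof, ?_, ?_, ?_, ?_⟩, rfl, rfl⟩
  · exact llp_rlp_eq_retractsCocell _ hV.exists_conesProj_factorization
  · refine hTrivFib.trans (llp_rlp_eq_retractsCocell _ fun f => ?_)
    obtain ⟨Z, i, p, hi, hp, fac⟩ := hV.exists_conesToZero_factorization f
    exact ⟨Z, i, p, hi, pullbacksProducts_le_cocell _ _ hp, fac⟩
  · rintro _ _ _ ⟨i, n⟩
    exact isPresentable_op_single _ _
  · rintro _ _ _ ⟨i, n⟩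
    exact isPresentable_of_isZero (isZero_zero _).op

end IsInjectiveCogenerator

/-! ### Banach spaces of bounded functions and of summable families -/

namespace Ban

/-- Continuous linear maps to `ℓ^∞(I)` extend from linear subspaces. -/
lemma exists_extension_linf {I : Type*} {E : Type*} [NormedAddCommGroup E] [NormedSpace ℝ E]
    (p : Submodule ℝ E) (a : p →L[ℝ] lp (fun _ : I => ℝ) ∞) :
    ∃ b : E →L[ℝ] lp (fun _ : I => ℝ) ∞, ∀ x : p, b x = a x := by
  -- Hahn–Banach in each coordinate without increasing the norm, so that the one bound `‖a‖` keeps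
  -- the extended coordinates in `ℓ^∞`.
  have h (i : I) : ∃ c : StrongDual ℝ E, (∀ x : p, c x = a x i) ∧ ‖c‖ ≤ ‖a‖ := by
    let φ : StrongDual ℝ p := LinearMap.mkContinuous
      { toFun := fun x => a x i
        map_add' := fun x y => by simp
        map_smul' := fun r x => by simp } ‖a‖
      fun x => (lp.norm_apply_le_norm (by simp) (a x) i).trans (a.le_opNorm x)
    obtain ⟨c, hc, hc'⟩ := exists_extension_norm_eq p φ
    exact ⟨c, hc, hc'.trans_le (LinearMap.mkContinuous_norm_le _ (norm_nonneg a) _)⟩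
  choose c hc hc' using h
  have le (x : E) (i : I) : ‖c i x‖ ≤ ‖a‖ * ‖x‖ :=
    ((c i).le_opNorm x).trans (by gcongr; exact hc' i)
  refine ⟨LinearMap.mkContinuous
    { toFun := fun x => ⟨fun i => c i x, memℓp_infty ⟨_, Set.forall_mem_range.2 (le x)⟩⟩
      map_add' := fun x y => lp.ext (funext fun i => map_add (c i) x y)
      map_smul' := fun r x => lp.ext (funext fun i => map_smul (c i) r x) } ‖a‖
    fun x => lp.norm_le_of_forall_le (by positivity) (le x), fun x => lp.ext (funext fun i => ?_)⟩
  exact hc i x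

/-- Every Banach space embeds isometrically into a Banach space of bounded functions. -/
lemma exists_linearIsometry_linf (V : Type u) [NormedAddCommGroup V] [NormedSpace ℝ V] :
    ∃ I : Type u, Nonempty (V →ₗᵢ[ℝ] lp (fun _ : I => ℝ) ∞) := by
  -- Functionals of norm at most 1 make evaluation bounded by `‖x‖`, and a norming functional
  -- attains this bound.
  let I := {c : StrongDual ℝ V // ‖c‖ ≤ 1}
  have le (x : V) (i : I) : ‖i.1 x‖ ≤ ‖x‖ :=
    (i.1.le_of_opNorm_le i.2 x).trans_eq (one_mul _)
  refine ⟨I, ⟨⟨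
    { toFun := fun x => ⟨fun i => i.1 x, memℓp_infty ⟨_, Set.forall_mem_range.2 (le x)⟩⟩
      map_add' := fun x y => lp.ext (funext fun i => map_add i.1 x y)
      map_smul' := fun r x => lp.ext (funext fun i => map_smul i.1 r x) }, fun x => ?_⟩⟩⟩
  refine le_antisymm (lp.norm_le_of_forall_le (norm_nonneg x) (le x)) ?_
  obtain ⟨g, hg, hgx⟩ := exists_dual_vector'' ℝ x
  refine le_trans ?_ (lp.norm_apply_le_norm (by simp) _ (⟨g, hg⟩ : I))
  change ‖x‖ ≤ ‖g x‖
  simp [hgx]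

/-- Every Banach space is the kernel of a morphism from a space of bounded functions. -/
lemma exists_kernelFork_linf (V : Ban.{u}) :
    ∃ (I : Type u) (Z : Ban.{u}) (e : V ⟶ linf I) (g : linf I ⟶ Z) (w : e ≫ g = 0),
      Nonempty (IsLimit (KernelFork.ofι e w)) := by
  obtain ⟨I, ⟨e⟩⟩ := exists_linearIsometry_linf V
  let S : Submodule ℝ (linf I) := LinearMap.range e.toLinearMap
  have hS : IsClosed (S : Set (linf I)) := e.isometry.isClosedEmbedding.isClosed_range
  have : IsClosed (S.toAddSubgroup : Set (linf I)) := hS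
  let Z : Ban.{u} := ⟨linf I ⧸ S⟩
  let q : linf I ⟶ Z := ofHom S.mkQL
  refine ⟨I, Z, ofHom e.toContinuousLinearMap, q,
    hom_ext fun x => (Submodule.Quotient.mk_eq_zero S).2 ⟨x, rfl⟩, ⟨?_⟩⟩
  have inS {W : Ban.{u}} (g : W ⟶ linf I) (hg : g ≫ q = 0) (x : W) : hom g x ∈ S :=
    (Submodule.Quotient.mk_eq_zero S).1 (DFunLike.congr_fun (congrArg hom hg) x)
  refine KernelFork.IsLimit.ofι _ _
    (fun {W} g hg => ofHom (e.equivRange.symm.toContinuousLinearEquiv.toContinuousLinearMap ∘L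
      (hom g).codRestrict S (inS g hg))) (fun {W} g hg => hom_ext fun x => ?_)
    (fun {W} g hg m hm => hom_ext fun x => e.injective ?_)
  · exact congr_arg Subtype.val (e.equivRange.apply_symm_apply ⟨hom g x, inS g hg x⟩)
  · refine (DFunLike.congr_fun (congrArg hom hm) x).trans ?_
    exact (congr_arg Subtype.val (e.equivRange.apply_symm_apply ⟨hom g x, inS g hg x⟩)).symm

/-- A small family of cocones over a discrete diagram of Banach spaces through which every cocone
factors: the `ℓ¹`-sum, with rescaled inclusions. -/
lemma exists_weakCoproducts {α : Type u} (V : α → Ban.{u}) :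
    ∃ (T : Type u) (S : T → Ban.{u}) (s : ∀ t a, V a ⟶ S t), ∀ (W : Ban.{u}) (f : ∀ a, V a ⟶ W),
      ∃ (t : T) (g : S t ⟶ W), ∀ a, s t a ≫ g = f a := by
  classical
  let s (N : α → ℕ) (a : α) : V a →L[ℝ] lp (fun a => V a) 1 :=
    (N a + 1 : ℝ) • LinearMap.mkContinuous (lp.lsingle (𝕜 := ℝ) (E := fun a => V a) 1 a) 1
      fun x => by rw [one_mul]; exact (lp.norm_single (E := fun a => V a) one_pos a x).le
  have hs (N a x) : s N a x = (N a + 1 : ℝ) • lp.single (E := fun a => V a) 1 a x := rfl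
  refine ⟨α → ℕ, fun _ => ⟨lp (fun a => V a) 1⟩, fun N a => ofHom (s N a), fun W f => ?_⟩
  -- The norms of the `f a` may be unbounded, so the maps need not extend to the `ℓ¹`-sum along its
  -- usual inclusions. Dividing by `N a + 1` makes them contractions; the inclusion carries the
  -- inverse factor, and the functions `N` form a small set.
  choose N hN using fun a => exists_nat_ge ‖hom (f a)‖
  have pos (a : α) : (0 : ℝ) < N a + 1 := by positivity
  let c (a : α) : V a →L[ℝ] W := (N a + 1 : ℝ)⁻¹ • hom (f a)
  have hc (a : α) (x : V a) : ‖c a x‖ ≤ ‖x‖ := by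
    change ‖(N a + 1 : ℝ)⁻¹ • hom (f a) x‖ ≤ ‖x‖
    rw [norm_smul, norm_inv, Real.norm_of_nonneg (pos a).le, inv_mul_le_iff₀ (pos a)]
    refine ((hom (f a)).le_opNorm x).trans ?_
    gcongr
    linarith [hN a]
  have hx (x : lp (fun a => V a) 1) : HasSum (fun a => ‖x a‖) ‖x‖ := by
    simpa using lp.hasSum_norm (p := 1) (by simp) x
  have hsum (x : lp (fun a => V a) 1) : Summable fun a => c a (x a) :=
    .of_norm_bounded (hx x).summable fun a => hc a (x a)
  let g : lp (fun a => V a) 1 →L[ℝ] W := LinearMap.mkContinuous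
    { toFun := fun x => ∑' a, c a (x a)
      map_add' := fun x y => by
        rw [← (hsum x).tsum_add (hsum y)]
        exact tsum_congr fun a => map_add (c a) _ _
      map_smul' := fun r x => by
        rw [RingHom.id_apply, ← (hsum x).tsum_const_smul r]
        exact tsum_congr fun a => map_smul (c a) r _ } 1
    fun x => by
      rw [one_mul]
      exact tsum_of_norm_bounded (hx x) fun a => hc a (x a)
  refine ⟨N, ofHom g, fun a => hom_ext fun x => ?_⟩
  change g (s N a x) = hom (f a) x
  rw [hs, map_smul]
  have : g (lp.single (E := fun a => V a) 1 a x) = c a x :=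
    (tsum_eq_single a fun b hb => by rw [lp.single_apply_ne _ _ _ hb, map_zero]).trans
      (by rw [lp.single_apply_self])
  rw [this]
  exact smul_inv_smul₀ (pos a).ne' _

end Ban

/-! ### Limits and finitely presentable objects in categories of ind-objects -/

namespace CategoryTheory

open Opposite

section

variable {C : Type u} [Category.{v} C]

/-- A product of representable presheaves is an ind-object if there is a small set of cones on the
family through one of which every cone factors. -/
lemma Limits.isIndObject_pi_yoneda [HasFiniteColimits C] {α : Type v} (g : α → C) {T : Type v}
    (S : T → C) (s : ∀ t a, S t ⟶ g a)
    (h : ∀ (W : C) (f : ∀ a, W ⟶ g a), ∃ (t : T) (k : W ⟶ S t), ∀ a, k ≫ s t a = f a) :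
    IsIndObject (∏ᶜ yoneda.obj ∘ g) := by
  let A : Cᵒᵖ ⥤ Type v := ∏ᶜ yoneda.obj ∘ g
  have hA : PreservesFiniteLimits A := by
    have : PreservesFiniteLimits (Discrete.functor (yoneda.obj ∘ g)).flip :=
      preservesFiniteLimits_of_evaluation _ fun i =>
        inferInstanceAs (PreservesFiniteLimits (yoneda.obj (g i.as)))
    exact preservesFiniteLimits_of_natIso (limitIsoFlipCompLim (Discrete.functor _)).symm
  -- Left exactness makes the category of elements filtered, and the given cones form a small weakly
  -- terminal set in it.
  have := isFiltered_costructuredArrow_yoneda_of_preservesFiniteLimits A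
  let P (t : T) : CostructuredArrow yoneda A :=
    CostructuredArrow.mk (Pi.lift fun a => yoneda.map (s t a))
  have : FinallySmall.{v} (CostructuredArrow yoneda A) := by
    refine finallySmall_of_small_weakly_terminal_set (Set.range P) fun X => ?_
    obtain ⟨t, k, hk⟩ := h X.left fun a =>
      Yoneda.fullyFaithful.preimage (X.hom ≫ Pi.π (yoneda.obj ∘ g) a)
    refine ⟨P t, ⟨t, rfl⟩, ⟨CostructuredArrow.homMk k ?_⟩⟩
    refine Pi.hom_ext _ _ fun a => ?_
    have h₁ : (P t).hom ≫ Pi.π (yoneda.obj ∘ g) a = yoneda.map (s t a) := Pi.lift_π _ _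
    rw [Category.assoc, h₁, ← Functor.map_comp, hk]
    exact Yoneda.fullyFaithful.map_preimage _
  exact isIndObject_of_isFiltered_of_finallySmall A

/-- If products of representable presheaves are ind-objects, then the category of ind-objects has
small limits. -/
lemma Ind.hasLimits [HasFiniteLimits C]
    (h : ∀ {α : Type v} (g : α → C), IsIndObject (∏ᶜ yoneda.obj ∘ g)) : HasLimits (Ind C) := by
  have (J : Type v) : HasLimitsOfShape (Discrete J) (Ind C) := by
    have : ObjectProperty.IsClosedUnderLimitsOfShape (IsIndObject (C := C)) (Discrete J) :=
      .mk' (by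
        rintro _ ⟨F, hF⟩
        exact isIndObject_limit_of_discrete h _ hF)
    have : CreatesLimitsOfShape (Discrete J) (Ind.inclusion C) := by
      unfold Ind.inclusion
      infer_instance
    exact hasLimitsOfShape_of_hasLimitsOfShape_createsLimitsOfShape (Ind.inclusion C)
  exact has_limits_of_hasEqualizers_and_products

/-- Morphisms from a representable ind-object to `Y` are the sections of the presheaf `Y`. -/
noncomputable def Ind.coyonedaObjYonedaIso (X : C) :
    coyoneda.obj (op (Ind.yoneda.obj X)) ≅ Ind.inclusion C ⋙ (evaluation _ _).obj (op X) :=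
  NatIso.ofComponents
    (fun Y => Equiv.toIso <| Ind.inclusion.fullyFaithful.homEquiv.trans <|
      ((Ind.yonedaCompInclusion.app X).homFromEquiv).trans yonedaEquiv)
    (fun {Y Z} f => by
      ext φ
      simp [yonedaEquiv, Iso.homFromEquiv, Functor.FullyFaithful.homEquiv])

/-- Both the inclusion of ind-objects in presheaves and evaluation at an object preserve filtered
colimits. -/
instance Ind.isFinitelyPresentable_yoneda_obj (X : C) :
    IsFinitelyPresentable.{v} (Ind.yoneda.obj X) := by
  rw [isFinitelyPresentable_iff_preservesFilteredColimits]
  refine ⟨fun J _ _ => ?_⟩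
  exact preservesColimitsOfShape_of_natIso (Ind.coyonedaObjYonedaIso X).symm

instance Pro.isFinitelyPresentable_op_const_obj (X : C) :
    IsFinitelyPresentable.{v} (op ((Pro.const C).obj X)) :=
  have := Cardinal.fact_isRegular_aleph0
  isCardinalPresentable_of_equivalence (Ind.yoneda.obj (op X)) _ (opOpEquivalence _).symm

end

end CategoryTheory

instance : HasLimits ProBan.{u} := inferInstance

instance : HasColimits ProBan.{u} := by
  have : HasLimits (Ind Ban.{u}ᵒᵖ) := Ind.hasLimits fun {α} g => by
    obtain ⟨T, S, s, h⟩ := Ban.exists_weakCoproducts fun a => (g a).unop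
    refine isIndObject_pi_yoneda g (fun t => .op (S t)) (fun t a => (s t a).op) fun W f => ?_
    obtain ⟨t, k, hk⟩ := h W.unop fun a => (f a).unop
    exact ⟨t, k.op, fun a => congr_arg Quiver.Hom.op (hk a)⟩
  infer_instance

/-! ### The spaces `ℓ^∞(I)` are injective cogenerators of the category of pro-Banach spaces -/

section Kernels

variable {C : Type u} [Category.{v} C] [Preadditive C]

/-- Small products of kernels are kernels. -/
lemma isLimit_kernelFork_pi [HasProducts.{v} C] {J : Type v} {X Y Z : J → C} {e : ∀ j, X j ⟶ Y j}
    {g : ∀ j, Y j ⟶ Z j} {w : ∀ j, e j ≫ g j = 0}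
    (h : ∀ j, Nonempty (IsLimit (KernelFork.ofι (e j) (w j)))) :
    ∃ w' : Limits.Pi.map e ≫ Limits.Pi.map g = 0,
      Nonempty (IsLimit (KernelFork.ofι (Limits.Pi.map e) w')) := by
  have w' : Limits.Pi.map e ≫ Limits.Pi.map g = 0 := by
    ext j
    simp [w]
  have (j : J) : Mono (e j) := mono_of_isLimit_fork (h j).some
  have hk {W : C} (k : W ⟶ ∏ᶜ Y) (hk : k ≫ Limits.Pi.map g = 0) (j : J) :
      (k ≫ Pi.π _ j) ≫ g j = 0 := by
    rw [Category.assoc, ← Pi.map_π, reassoc_of% hk, zero_comp]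
  refine ⟨w', ⟨KernelFork.IsLimit.ofι' _ _ fun {W} k hk' =>
    ⟨Pi.lift fun j => (h j).some.lift (KernelFork.ofι _ (hk k hk' j)), ?_⟩⟩⟩
  ext j
  rw [Category.assoc, Pi.map_π, Pi.lift_π_assoc]
  exact (h j).some.fac _ WalkingParallelPair.zero

/-- A limit is the kernel of a morphism between products. -/
lemma exists_isLimit_kernelFork_of_isLimit [HasProducts.{v} C] {J : Type v} [SmallCategory J]
    {F : J ⥤ C} {c : Cone F} (hc : IsLimit c) :
    ∃ (Z : C) (g : ∏ᶜ F.obj ⟶ Z) (w : Pi.lift c.π.app ≫ g = 0),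
      Nonempty (IsLimit (KernelFork.ofι (Pi.lift c.π.app) w)) := by
  let g : ∏ᶜ F.obj ⟶ ∏ᶜ fun f : (Σ p : J × J, p.1 ⟶ p.2) => F.obj f.1.2 :=
    Pi.lift fun f => Pi.π _ f.1.1 ≫ F.map f.2 - Pi.π _ f.1.2
  have w : Pi.lift c.π.app ≫ g = 0 := by
    ext f
    simp [g]
  have : Mono (Pi.lift c.π.app) := ⟨fun a b hab => hc.hom_ext fun j => by
    simpa using hab =≫ Pi.π _ j⟩
  refine ⟨_, g, w, ⟨KernelFork.IsLimit.ofι' _ _ fun {W} k hk =>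
    ⟨hc.lift ⟨W, { app := fun j => k ≫ Pi.π _ j, naturality := fun j j' f => ?_ }⟩, ?_⟩⟩⟩
  · have := hk =≫ Pi.π _ ⟨⟨j, j'⟩, f⟩
    rw [zero_comp, Category.assoc, Pi.lift_π, Preadditive.comp_sub, sub_eq_zero] at this
    simpa using! this.symm
  · ext j
    simp

/-- The composition of a kernel with a kernel `m` is a kernel, if the morphism defining the first
one extends along `m`, up to a monomorphism. -/
lemma isLimit_kernelFork_comp [HasBinaryProducts C] {X Y Z W G E : C} {e : X ⟶ Y} {g : Y ⟶ Z}
    {w : e ≫ g = 0} (he : IsLimit (KernelFork.ofι e w)) {m : Y ⟶ E} {q : E ⟶ W} {w' : m ≫ q = 0}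
    (hm : IsLimit (KernelFork.ofι m w')) {z : Z ⟶ G} [Mono z] {b : E ⟶ G} (hb : m ≫ b = g ≫ z) :
    ∃ w : (e ≫ m) ≫ prod.lift q b = 0, Nonempty (IsLimit (KernelFork.ofι (e ≫ m) w)) := by
  have : Mono e := mono_of_isLimit_fork he
  have : Mono m := mono_of_isLimit_fork hm
  have w'' : (e ≫ m) ≫ prod.lift q b = 0 := by
    ext
    · rw [Category.assoc, prod.lift_fst, Category.assoc, w', comp_zero, zero_comp]
    · rw [Category.assoc, prod.lift_snd, Category.assoc, hb, reassoc_of% w, zero_comp, zero_comp]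
  refine ⟨w'', ⟨KernelFork.IsLimit.ofι' _ _ fun {T} k hk => ?_⟩⟩
  have h₁ : k ≫ q = 0 := by rw [← prod.lift_fst q b, reassoc_of% hk, zero_comp]
  have h₂ : k ≫ b = 0 := by rw [← prod.lift_snd q b, reassoc_of% hk, zero_comp]
  let l : T ⟶ Y := hm.lift (KernelFork.ofι k h₁)
  have hl : l ≫ m = k := hm.fac _ WalkingParallelPair.zero
  have h₃ : l ≫ g = 0 := by
    rw [← cancel_mono z, Category.assoc, ← hb, reassoc_of% hl, h₂, zero_comp]
  refine ⟨he.lift (KernelFork.ofι l h₃), ?_⟩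
  have : he.lift (KernelFork.ofι l h₃) ≫ e = l := he.fac _ WalkingParallelPair.zero
  rw [reassoc_of% this, hl]

/-- A criterion for injective cogenerators: every object is a limit of kernels of morphisms
defined on objects of the family. -/
lemma IsInjectiveCogenerator.of_isLimit [HasKernels C] [HasProducts.{v} C] [HasBinaryProducts C]
    {ι : Type*} {V : ι → C} (h : ∀ {X Y : C} (g : X ⟶ Y), hasExtensions V (kernel.ι g))
    {κ : Type*} {U : κ → C}
    (hU : ∀ k, ∃ (i : ι) (Z : C) (e : U k ⟶ V i) (g : V i ⟶ Z) (w : e ≫ g = 0),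
      Nonempty (IsLimit (KernelFork.ofι e w)))
    (hC : ∀ X : C, ∃ (J : Type v) (_ : SmallCategory J) (F : J ⥤ C) (c : Cone F) (_ : IsLimit c)
      (k : J → κ), c.pt = X ∧ ∀ j, F.obj j = U (k j)) : IsInjectiveCogenerator V := by
  choose i Z e g w hk using hU
  have key (X : C) : ∃ (J : Type v) (k : J → κ) (Z : C) (e : X ⟶ ∏ᶜ fun j => U (k j))
      (g : (∏ᶜ fun j => U (k j)) ⟶ Z) (w : e ≫ g = 0), Nonempty (IsLimit (KernelFork.ofι e w)) := by
    obtain ⟨J, _, F, c, hc, k, rfl, hF⟩ := hC X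
    have : ∃ (Z : C) (e : c.pt ⟶ ∏ᶜ F.obj) (g : ∏ᶜ F.obj ⟶ Z) (w : e ≫ g = 0),
        Nonempty (IsLimit (KernelFork.ofι e w)) := by
      obtain ⟨Z, g, w, hw⟩ := exists_isLimit_kernelFork_of_isLimit hc
      exact ⟨Z, _, g, w, hw⟩
    rw [show F.obj = fun j => U (k j) from funext hF] at this
    exact ⟨J, k, this⟩
  refine ⟨h, fun X => ?_⟩
  obtain ⟨J, k, Z', e', g', w', ⟨hk'⟩⟩ := key X
  -- The map `g'` must be extended from the product of the `U` to the product of the `V`, so its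
  -- target `Z'` is first embedded in a product of injectives.
  obtain ⟨J₂, k₂, Z₂, e₂, g₂, w₂, ⟨hk₂⟩⟩ := key Z'
  obtain ⟨ww, ⟨hw⟩⟩ := isLimit_kernelFork_pi fun j => hk (k j)
  obtain ⟨ww₂, ⟨hw₂⟩⟩ := isLimit_kernelFork_pi fun j => hk (k₂ j)
  have : Mono e₂ := mono_of_isLimit_fork hk₂
  have : Mono (Limits.Pi.map fun j => e (k₂ j)) := mono_of_isLimit_fork hw₂
  have : Mono (e₂ ≫ Limits.Pi.map fun j => e (k₂ j)) := mono_comp _ _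
  obtain ⟨b, hb⟩ := ((h _).of_isLimit hw).exists_extension_pi (fun j => i (k₂ j))
    (g' ≫ e₂ ≫ Limits.Pi.map fun j => e (k₂ j))
  obtain ⟨w, hw⟩ := isLimit_kernelFork_comp hk' hw hb
  exact ⟨J, fun j => i (k j), _, _, _, w, hw⟩

end Kernels

/-! ### Passage of injectivity from Banach spaces to pro-Banach spaces -/

namespace CategoryTheory

open Opposite

variable {C : Type u} [Category.{v} C]

/-- If morphisms from `J` lift along the coequalizers of `C`, then morphisms from `J` also lift
along the coequalizers of ind-objects. -/
lemma Ind.exists_lift_of_isColimit_cofork [HasFiniteColimits C] {J : C}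
    (hJ : ∀ {D : WalkingParallelPair ⥤ C} {s : Cocone D}, IsColimit s → ∀ a : J ⟶ s.pt,
      ∃ b, b ≫ s.ι.app WalkingParallelPair.one = a)
    {A B : Ind C} {f g : A ⟶ B} {c : Cofork f g} (hc : IsColimit c) (a : Ind.yoneda.obj J ⟶ c.pt) :
    ∃ b, b ≫ c.π = a := by
  -- The pair is presented levelwise, so its coequalizer is the filtered colimit of the levelwise
  -- ones. By finite presentability `a` factors through one level, where `hJ` applies.
  obtain ⟨P⟩ := nonempty_indParallelPairPresentation A.isIndObject_inclusion_obj
    B.isIndObject_inclusion_obj ((Ind.inclusion _).map f) ((Ind.inclusion _).map g)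
  let e := P.parallelPairIsoParallelPairCompIndYoneda
  let s := colimit.cocone (parallelPair P.φ P.ψ)
  have hs : IsColimit s := colimit.isColimit _
  let t := (Cocone.precompose e.hom).obj ((Ind.lim P.I).mapCocone s)
  have ht : IsColimit t := (IsColimit.precomposeHomEquiv e _).symm (isColimitOfPreserves _ hs)
  obtain ⟨i, a', ha'⟩ := IsFinitelyPresentable.exists_hom_of_isColimit
    (colimit.isColimit (s.pt ⋙ Ind.yoneda)) (a ≫ (hc.coconePointUniqueUpToIso ht).hom)
  obtain ⟨b, hb⟩ := hJ (isColimitOfPreserves ((evaluation _ _).obj i) hs)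
    (Ind.yoneda.fullyFaithful.preimage a')
  let b' : Ind.yoneda.obj J ⟶ (Ind.lim P.I).obj P.F₂ :=
    Ind.yoneda.map b ≫ colimit.ι (P.F₂ ⋙ Ind.yoneda) i
  refine ⟨b' ≫ e.inv.app .one, ?_⟩
  rw [← cancel_mono (hc.coconePointUniqueUpToIso ht).hom]
  refine Eq.trans ?_ ha'
  have h₁ : c.π ≫ (hc.coconePointUniqueUpToIso ht).hom = e.hom.app .one ≫ (Ind.lim P.I).map
      (s.ι.app .one) := hc.comp_coconePointUniqueUpToIso_hom ht .one
  rw [Category.assoc, Category.assoc, h₁, Iso.inv_hom_id_app_assoc]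
  have h₂ : colimit.ι (P.F₂ ⋙ Ind.yoneda) i ≫ (Ind.lim P.I).map (s.ι.app .one) =
      Ind.yoneda.map ((s.ι.app .one).app i) ≫ colimit.ι (s.pt ⋙ Ind.yoneda) i :=
    ι_colimMap _ _
  have h₃ : Ind.yoneda.map b ≫ Ind.yoneda.map ((s.ι.app .one).app i) = a' := by
    rw [← Functor.map_comp]
    exact (congr_arg Ind.yoneda.map hb).trans (Ind.yoneda.fullyFaithful.map_preimage a')
  exact (Category.assoc _ _ _).trans <| (congr_arg (Ind.yoneda.map b ≫ ·) h₂).trans <|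
    (Category.assoc _ _ _).symm.trans <| congr_arg (· ≫ colimit.ι (s.pt ⋙ Ind.yoneda) i) h₃

end CategoryTheory

namespace CategoryTheory

open Opposite

variable {C : Type u} [Category.{v} C]

instance Pro.preservesFiniteLimits_const : PreservesFiniteLimits (Pro.const C) :=
  preservesFiniteLimits_rightOp _

/-- Every pro-object is a limit of constant pro-objects. -/
lemma Pro.exists_isLimit_const (X : Pro C) :
    ∃ (J : Type v) (_ : SmallCategory J) (F : J ⥤ Pro C) (c : Cone F) (_ : IsLimit c)
      (k : J → C), c.pt = X ∧ ∀ j, F.obj j = (Pro.const C).obj (k j) := by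
  let P := X.unop.presentation
  let c : Cocone (P.F ⋙ Ind.yoneda) :=
    (colimit.cocone _).extend X.unop.colimitPresentationCompYoneda.hom
  have hc : IsColimit c := IsColimit.extendIso _ (colimit.isColimit _)
  exact ⟨P.Iᵒᵖ, inferInstance, _, c.op, hc.op, fun j => (P.F.obj j.unop).unop, rfl, fun j => rfl⟩

end CategoryTheory

/-- Morphisms to `ℓ^∞(I)` extend along the equalizers of Banach spaces. -/
lemma Ban.exists_lift_op_linf (I : Type u) {D : WalkingParallelPair ⥤ Ban.{u}ᵒᵖ} {s : Cocone D}
    (hs : IsColimit s) (a : Opposite.op (Ban.linf I) ⟶ s.pt) :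
    ∃ b, b ≫ s.ι.app WalkingParallelPair.one = a := by
  let E : Ban.{u} := (D.obj .one).unop
  let l : E ⟶ (D.obj .zero).unop := (D.map .left).unop
  let r : E ⟶ (D.obj .zero).unop := (D.map .right).unop
  let j : s.pt.unop ⟶ E := (s.ι.app .one).unop
  have hj' : j ≫ (l - r) = 0 := by
    rw [Preadditive.comp_sub, sub_eq_zero]
    exact congr_arg Quiver.Hom.unop ((s.w .left).trans (s.w .right).symm)
  -- The abstract equalizer is compared with the concrete closed subspace, to which Hahn–Banach
  -- applies.
  let p : Submodule ℝ E := LinearMap.ker (hom (l - r)).toLinearMap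
  have : CompleteSpace p := (ContinuousLinearMap.isClosed_ker (hom (l - r))).completeSpace_coe
  let P : Ban.{u} := ⟨p⟩
  let m : P ⟶ E := ofHom p.subtypeL
  have hm : m ≫ l = m ≫ r := by
    rw [← sub_eq_zero, ← Preadditive.comp_sub]
    exact hom_ext fun x => x.2
  let t : Cofork (D.map .left) (D.map .right) := Cofork.ofπ m.op (congr_arg Quiver.Hom.op hm)
  let t' : Cocone D := (Cocone.precompose (diagramIsoParallelPair D).hom).obj t
  let w : P ⟶ s.pt.unop := (hs.desc t').unop
  have hw : w ≫ j = m := by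
    refine congr_arg Quiver.Hom.unop ((hs.fac t' .one).trans ?_)
    exact Category.id_comp _
  let q : s.pt.unop ⟶ P := ofHom ((hom j).codRestrict p
    fun x => DFunLike.congr_fun (congrArg hom hj') x)
  have hq : q ≫ m = j := rfl
  have hqw : q ≫ w = 𝟙 _ := by
    refine congr_arg Quiver.Hom.unop (hs.hom_ext (f := (q ≫ w).op) (f' := 𝟙 _) fun k => ?_)
    have h₁ : s.ι.app .one ≫ (q ≫ w).op = s.ι.app .one ≫ 𝟙 _ :=
      congr_arg Quiver.Hom.op (show (q ≫ w) ≫ j = 𝟙 _ ≫ j by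
        rw [Category.assoc, hw, hq, Category.id_comp])
    obtain _ | _ := k
    · rw [← s.w .left, Category.assoc, Category.assoc, h₁]
      rfl
    · exact h₁
  obtain ⟨b, hb⟩ := exists_extension_linf p (hom (w ≫ a.unop))
  have hmb : m ≫ ofHom b = w ≫ a.unop := hom_ext hb
  refine ⟨(ofHom b : E ⟶ linf I).op, congr_arg Quiver.Hom.op (show j ≫ ofHom b = a.unop from ?_)⟩
  rw [← hq, Category.assoc, hmb, ← Category.assoc, hqw, Category.id_comp]

lemma ProBan.hasExtensions_kernel {X Y : ProBan.{u}} (g : X ⟶ Y) :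
    hasExtensions (fun I => (Pro.const _).obj (Ban.linf.{u} I)) (kernel.ι g) := fun I a => by
  have w : g.unop ≫ (kernel.ι g).unop = 0 := congr_arg Quiver.Hom.unop (kernel.condition g)
  have hc : IsColimit (CokernelCofork.ofπ (kernel.ι g).unop w) :=
    CokernelCofork.IsColimit.ofπ _ _
      (fun k hk => (kernel.lift g k.op (congr_arg Quiver.Hom.op hk)).unop)
      (fun k hk => congr_arg Quiver.Hom.unop (kernel.lift_ι g k.op _))
      (fun k hk m hm => congr_arg Quiver.Hom.unop <| show m.op = _ by
        rw [← cancel_mono (kernel.ι g), kernel.lift_ι]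
        exact congr_arg Quiver.Hom.op hm)
  obtain ⟨b, hb⟩ := Ind.exists_lift_of_isColimit_cofork (Ban.exists_lift_op_linf I) hc a.unop
  exact ⟨b.op, congr_arg Quiver.Hom.op hb⟩

lemma ProBan.isInjectiveCogenerator_linf :
    IsInjectiveCogenerator fun I => (Pro.const _).obj (Ban.linf.{u} I) := by
  have : (Pro.const Ban.{u}).PreservesZeroMorphisms :=
    Functor.preservesZeroMorphisms_of_preserves_terminal_object
  refine .of_isLimit ProBan.hasExtensions_kernel (U := (Pro.const Ban.{u}).obj) (fun V => ?_)
    Pro.exists_isLimit_const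
  obtain ⟨I, Z, e, g, w, ⟨h⟩⟩ := Ban.exists_kernelFork_linf V
  have w' : (Pro.const _).map e ≫ (Pro.const _).map g = 0 := by
    rw [← Functor.map_comp, w, Functor.map_zero]
  exact ⟨I, _, _, _, w', ⟨KernelFork.mapIsLimit _ h (Pro.const _)⟩⟩

theorem mainTheorem7 :
    HasLimits ChProBan.{u} ∧ HasColimits ChProBan.{u} ∧
      ∃ _ : ModelCategory ChProBan.{u},
        IsFibrantlyCogenerated ChProBan.{u}
          ChProBan.cogeneratingFibrations ChProBan.cogeneratingTrivialFibrations ∧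
        weakEquivalences ChProBan.{u} = strictQuasiIso ProBan.{u} ∧
        cofibrations ChProBan.{u} = levelwiseStrictMono ProBan.{u} :=
  ⟨inferInstance, inferInstance, ProBan.isInjectiveCogenerator_linf.exists_modelCategory⟩
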